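/- Let $\alpha\in(1,2)$. Consider a single round of a two-party protocol. It has finite input alphabets $\mathcal X,\mathcal Y$, finite output alphabets $\mathcal A,\mathcal B$, a test/key bit $t\in\{0,1\}$, a joint distribution $\operatorname{P}(x,y,t)$ of inputs and bit, and a function $f$ into a finite alphabet giving the test data $\bar c=f(a,b,x,y,t)$. For each $x$ (resp. $y$) let $\{M_{a|x}\}_a$ (resp. $\{N_{b|y}\}_b$) be a POVM on the finite-dimensional space $Q_A$ (resp. $Q_B$), and let $\sigma_{Q_AQ_BE}$ be a normalized state on finite-dimensional $Q_A\otimes Q_B\otimes E$. Put $$\mathcal M(\sigma)_{A\bar CE|x,y,t}=\sum_{a,b}|a,\bar c\rangle\langle a,\bar c|\otimes \operatorname{Tr}_{Q_AQ_B}\big[(M_{a|x}\otimes N_{b|y}\otimes \mathbb 1_E)\sigma\big],\qquad \bar c=f(a,b,x,y,t),$$ $$\mathcal M(\sigma)_{A\bar CXYTE}=\sum_{x,y,t}\operatorname{P}(x,y,t)\,\mathcal M(\sigma)_{A\bar CE|x,y,t}\otimes|x,y,t\rangle\langle x,y,t|.$$ The subscript $\wedge\bar c$ denotes the (unnormalized)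 block at $\bar C=\bar c$, omitted registers are traced out, negative powers are taken on the support, and $\operatorname{P}(\bar c|x,y,t)$, $\operatorname{P}(a|\bar c,x,y,t)$ are the probabilities induced by the measurements on $\sigma$. Let $$p(\bar c)=\operatorname{Tr}\big[\mathcal M(\sigma)_{AXYTE\wedge\bar c}^{\alpha}\cdot \mathbb 1_A\otimes\mathcal M(\sigma)_{XYTE}^{1-\alpha}\big].$$ (i) For every value $\bar c$, $$p(\bar c)=\sum_{x,y,t:\ \operatorname{P}(\bar c|x,y,t)>0}\operatorname{P}(x,y,t)\operatorname{Tr}\big[\mathcal M(\sigma)_{AE\wedge\bar c|x,y,t}^{\alpha}\cdot \mathbb 1_A\otimes\mathcal M(\sigma)_E^{1-\alpha}\big].$$ (ii) For every $m\in\mathbb N$ there are nodes $t_1,\dots,t_m\in(0,1]$ and weights $w_1,\dots,w_m>0$, depending only on $\alpha$ and $m$, such that for all such rounds, all $\bar c$ and all $x,y,t$, the trace $\operatorname{Tr}\big[\mathcal M(\sigma)_{AE\wedge\bar c|x,y,t}^{\alpha}\cdot \mathbb 1_A\otimes\mathcal M(\sigma)_E^{1-\alpha}\big]$ is at most the (finite)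 supremum $$\sup_{Z_{a,i}^{x,y,t}}\ \sum_{a:\ \operatorname{P}(a|\bar c,x,y,t)>0}\operatorname{Tr}\Big[\sigma\Big(\sum_{b:\ f(a,b,x,y,t)=\bar c}M_{a|x}\otimes N_{b|y}\otimes P(Z_{a,1}^{x,y,t},\dots,Z_{a,m}^{x,y,t})+\mathbb 1_{Q_AQ_B}\otimes Q(Z_{a,1}^{x,y,t},\dots,Z_{a,m}^{x,y,t})\Big)\Big]$$ over all families of operators $Z_{a,i}^{x,y,t}$ acting on $E$, where $$P(Z_1,\dots,Z_m)=\mathbb 1+\frac{\sin(\alpha\pi)}{\pi}\sum_{i=1}^m\frac{w_i}{t_i}\big(\mathbb 1+Z_i+Z_i^\dagger+(1-t_i)Z_i^\dagger Z_i\big),\qquad Q(Z_1,\dots,Z_m)=\frac{\sin(\alpha\pi)}{\pi}\sum_{i=1}^m w_iZ_iZ_i^\dagger .$$ (If $\operatorname{P}(\bar c|x,y,t)=0$, both the trace and the empty sum are $0$.) -/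

import Mathlib

open scoped Kronecker Matrix ComplexOrder

noncomputable section

namespace RenyiDI

/-- Real power `ρ ^ s` of a positive semidefinite matrix, by functional calculus on its eigenvalues.
For `s < 0` the power is taken on the support of `ρ`, since `(0 : ℝ) ^ s = 0` for `s ≠ 0`. -/
def mpow {n : Type*} [Fintype n] [DecidableEq n] (ρ : Matrix n n ℂ) (s : ℝ) : Matrix n n ℂ :=
  cfc (fun r : ℝ => r ^ s) ρ

/-- The partial trace `Tr_{Q_A Q_B}` of an operator on `Q_A ⊗ Q_B ⊗ E`. -/
def ptraceAB {qA qB e : Type*} [Fintype qA] [Fintype qB]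
    (S : Matrix (qA × qB × e) (qA × qB × e) ℂ) : Matrix e e ℂ :=
  Matrix.of fun k k' => ∑ i, ∑ j, S (i, j, k) (i, j, k')

/-- A POVM with outcomes in `O`. -/
structure IsPOVM {O n : Type*} [Fintype O] [Fintype n] [DecidableEq n]
    (M : O → Matrix n n ℂ) : Prop where
  posSemidef : ∀ o, (M o).PosSemidef
  sum_eq_one : ∑ o, M o = 1

/-- The data of a single round. `X`, `Y` are the input alphabets, `A`, `B` the output alphabets
(outcomes that do not occur for a given input have zero POVM element), `C` the alphabet of the test
data, `T ∈ {0, 1}` the key/test bit, and `ℂ^qA`, `ℂ^qB`, `ℂ^e` the spaces of `Q_A`, `Q_B`, `E`. -/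
structure SingleRound (X Y A B C qA qB e : Type*) [Fintype X] [Fintype Y] [Fintype A] [Fintype B]
    [Fintype qA] [Fintype qB] [Fintype e] [DecidableEq qA] [DecidableEq qB] where
  /-- `P(X = x, Y = y, T = t)` -/
  P : X → Y → Fin 2 → ℝ
  P_nonneg : ∀ x y t, 0 ≤ P x y t
  P_sum : ∑ x, ∑ y, ∑ t, P x y t = 1
  /-- the test data as a function `f(a, b, x, y, t)` -/
  f : A → B → X → Y → Fin 2 → C
  /-- Alice's measurements: `M x a` is `M_{a|x}` -/
  M : X → A → Matrix qA qA ℂ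
  M_povm : ∀ x, IsPOVM (M x)
  /-- Bob's measurements: `N y b` is `N_{b|y}` -/
  N : Y → B → Matrix qB qB ℂ
  N_povm : ∀ y, IsPOVM (N y)
  /-- the state `σ` on `Q_A ⊗ Q_B ⊗ E` -/
  σ : Matrix (qA × qB × e) (qA × qB × e) ℂ
  σ_posSemidef : σ.PosSemidef
  σ_trace : σ.trace = 1

namespace SingleRound

variable {X Y A B C qA qB e : Type*} [Fintype X] [Fintype Y] [Fintype A] [Fintype B] [Fintype C]
  [Fintype qA] [Fintype qB] [Fintype e] [DecidableEq X] [DecidableEq Y] [DecidableEq A]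
  [DecidableEq C] [DecidableEq qA] [DecidableEq qB] [DecidableEq e]

/-- `M(σ)_{A C̄ E | X=x, Y=y, T=t}`, that is
`∑_{a,b} |a,c̄⟩⟨a,c̄| ⊗ Tr_{Q_A Q_B}[(M_{a|x} ⊗ N_{b|y} ⊗ 1) σ]` with `c̄ = f(a,b,x,y,t)`. -/
def condOut (R : SingleRound X Y A B C qA qB e) (x : X) (y : Y) (t : Fin 2) :
    Matrix (A × C × e) (A × C × e) ℂ :=
  ∑ a, ∑ b, Matrix.single a a (1 : ℂ) ⊗ₖ
    (Matrix.single (R.f a b x y t) (R.f a b x y t) (1 : ℂ) ⊗ₖ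
      ptraceAB ((R.M x a ⊗ₖ (R.N y b ⊗ₖ (1 : Matrix e e ℂ))) * R.σ))

/-- The output `M(σ)_{A C̄ X Y T E}` of the round, that is
`∑_{x,y,t} P(x,y,t) M(σ)_{A C̄ E | x,y,t} ⊗ |x,y,t⟩⟨x,y,t|`. -/
def out (R : SingleRound X Y A B C qA qB e) :
    Matrix ((A × C × e) × (X × Y × Fin 2)) ((A × C × e) × (X × Y × Fin 2)) ℂ :=
  ∑ x, ∑ y, ∑ t, (R.P x y t) •
    (R.condOut x y t ⊗ₖ Matrix.single (x, y, t) (x, y, t) (1 : ℂ))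

/-- The partial state `M(σ)_{A X Y T E ∧ c̄}`: the block of `M(σ)_{A C̄ X Y T E}` at `C̄ = c`. -/
def outTest (R : SingleRound X Y A B C qA qB e) (c : C) :
    Matrix (A × e × (X × Y × Fin 2)) (A × e × (X × Y × Fin 2)) ℂ :=
  Matrix.of fun i j => R.out ((i.1, c, i.2.1), i.2.2) ((j.1, c, j.2.1), j.2.2)

/-- The marginal `M(σ)_{X Y T E}`. -/
def outXYTE (R : SingleRound X Y A B C qA qB e) :
    Matrix (e × (X × Y × Fin 2)) (e × (X × Y × Fin 2)) ℂ :=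
  Matrix.of fun i j => ∑ a, ∑ c, R.out ((a, c, i.1), i.2) ((a, c, j.1), j.2)

/-- The marginal `M(σ)_E`. -/
def outE (R : SingleRound X Y A B C qA qB e) : Matrix e e ℂ :=
  Matrix.of fun k k' => ∑ a, ∑ c, ∑ v, R.out ((a, c, k), v) ((a, c, k'), v)

/-- The partial state `M(σ)_{A E ∧ c̄ | X=x, Y=y, T=t}`. -/
def condTest (R : SingleRound X Y A B C qA qB e) (c : C) (x : X) (y : Y) (t : Fin 2) :
    Matrix (A × e) (A × e) ℂ :=
  Matrix.of fun i j => R.condOut x y t (i.1, c, i.2) (j.1, c, j.2)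

/-- `p(c̄) = Tr[M(σ)_{A X Y T E ∧ c̄}^α · 1_A ⊗ M(σ)_{X Y T E}^{1-α}]`. -/
def p (R : SingleRound X Y A B C qA qB e) (α : ℝ) (c : C) : ℂ :=
  (mpow (R.outTest c) α * ((1 : Matrix A A ℂ) ⊗ₖ mpow R.outXYTE (1 - α))).trace

/-- `Tr[M(σ)_{A E ∧ c̄ | x,y,t}^α · 1_A ⊗ M(σ)_E^{1-α}]`. -/
def condTerm (R : SingleRound X Y A B C qA qB e) (α : ℝ) (c : C) (x : X) (y : Y) (t : Fin 2) : ℂ :=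
  (mpow (R.condTest c x y t) α * ((1 : Matrix A A ℂ) ⊗ₖ mpow R.outE (1 - α))).trace

/-- The outcome probability `P(a, b | x, y)` given by the Born rule. -/
def born (R : SingleRound X Y A B C qA qB e) (a : A) (b : B) (x : X) (y : Y) : ℝ :=
  (((R.M x a ⊗ₖ (R.N y b ⊗ₖ (1 : Matrix e e ℂ))) * R.σ).trace).re

/-- `P(a, c̄ | x, y, t)`. -/
def probAC (R : SingleRound X Y A B C qA qB e) (a : A) (c : C) (x : X) (y : Y) (t : Fin 2) : ℝ :=
  ∑ b with R.f a b x y t = c, R.born a b x y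

/-- `P(c̄ | x, y, t)`. -/
def probC (R : SingleRound X Y A B C qA qB e) (c : C) (x : X) (y : Y) (t : Fin 2) : ℝ :=
  ∑ a, R.probAC a c x y t

/-- `P(a | c̄, x, y, t)` (equal to `0` when `P(c̄ | x, y, t) = 0`). -/
def probAgivenC (R : SingleRound X Y A B C qA qB e) (a : A) (c : C) (x : X) (y : Y)
    (t : Fin 2) : ℝ :=
  R.probAC a c x y t / R.probC c x y t

end SingleRound

/-- `P(Z_1, …, Z_m) = 1 + (sin(απ)/π) ∑_i (w_i/t_i) (1 + Z_i + Z_i† + (1 - t_i) Z_i† Z_i)`. -/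
def polyP {e : Type*} [Fintype e] [DecidableEq e] (α : ℝ) {m : ℕ} (t w : Fin m → ℝ)
    (Z : Fin m → Matrix e e ℂ) : Matrix e e ℂ :=
  1 + (Real.sin (α * Real.pi) / Real.pi) •
    ∑ i, (w i / t i) • (1 + Z i + (Z i)ᴴ + (1 - t i) • ((Z i)ᴴ * Z i))

/-- `Q(Z_1, …, Z_m) = (sin(απ)/π) ∑_i w_i Z_i Z_i†`. -/
def polyQ {e : Type*} [Fintype e] (α : ℝ) {m : ℕ} (w : Fin m → ℝ)
    (Z : Fin m → Matrix e e ℂ) : Matrix e e ℂ :=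
  (Real.sin (α * Real.pi) / Real.pi) • ∑ i, w i • (Z i * (Z i)ᴴ)

/-- The objective
`∑_a Tr[σ (∑_b M_{a|x} ⊗ N_{b|y} ⊗ P(Z_{a,1}, …) + 1 ⊗ Q(Z_{a,1}, …))]`,
over `a` with `P(a | c̄, x, y, t) > 0` and, for each `a`, over `b` with `c̄ = f(a, b, x, y, t)`.
The traces are real since all operators are Hermitian. The nodes are called `s` here because `t` is
the key/test bit. -/
def SingleRound.objective {X Y A B C qA qB e : Type*} [Fintype X] [Fintype Y] [Fintype A]
    [Fintype B] [Fintype qA] [Fintype qB] [Fintype e] [DecidableEq C]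
    [DecidableEq qA] [DecidableEq qB] [DecidableEq e]
    (R : SingleRound X Y A B C qA qB e) (α : ℝ) {m : ℕ} (s w : Fin m → ℝ)
    (c : C) (x : X) (y : Y) (t : Fin 2) (Z : A → Fin m → Matrix e e ℂ) : ℝ :=
  ∑ a with 0 < R.probAgivenC a c x y t,
    ((R.σ * ((∑ b with R.f a b x y t = c, R.M x a ⊗ₖ (R.N y b ⊗ₖ polyP α s w (Z a))) +
      (1 : Matrix qA qA ℂ) ⊗ₖ ((1 : Matrix qB qB ℂ) ⊗ₖ polyQ α w (Z a)))).trace).re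

end RenyiDI

end

/-! For (i), both operators are block diagonal in `(x, y, t)`, and a power acts block by block. The
scalars `P ^ α` and `P ^ (1 - α)` multiply to `P`, and blocks with `probC = 0` vanish.

For (ii), `condTerm_eq` splits the trace over `a` into terms `Tr[ρ ^ α τ ^ (1 - α)]`, where `ρ` is
the unnormalized state of `E` for `(a, c̄)` and `τ` is the marginal on `E`, so `0 ≤ ρ ≤ τ`. In
eigenbases `u_i` of `ρ` and `v_j` of `τ`, each term is the sum of `λ_i ^ α μ_j ^ (1 - α) |⟨v_j,
u_i⟩|²`, which reduces the bound to a scalar one for `x ^ (α - 1)` at `x = λ_i / μ_j`.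

The scalar bound is `GaussRadau.exists_rpow_le`. For `0 < β < 1`, `x ^ β - 1` is a positive multiple
of the integral of `(x - 1) / ((1 - t) x + t)` against `t ^ β (1 - t) ^ (-β)` on `(0, 1)`. A
Gauss–Radau rule with fixed node `1` overestimates this integral for every `x > 0`: the Hermite
interpolant at its nodes majorizes the integrand (`exists_majorant`), and the rule integrates that
interpolant exactly (`IsPositive.exists_quadrature`).

After homogenization, each quadrature term is, up to sign, the minimum over `z` of a quadratic
polynomial. The minimizers `z_ij` are assembled into one operator `Z` with entries `z_ij ⟨v_j, u_i⟩`
between the two eigenbases (`nodeTerm_spectral`, `exists_trace_mpow_le`). Since `sin(απ) < 0`, these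
minima become values of the objective. The supremum is finite because `nodeTerm` is nonnegative when
`0 ≤ ρ ≤ τ` (`nodeTerm_nonneg`). -/

namespace GaussRadau

/-! ### Gauss–Radau quadrature for positive functionals. -/

open Polynomial MeasureTheory

/-- A linear functional on real polynomials that is positive on nonzero polynomials which are
nonnegative on `(0, 1)`. -/
def IsPositive (L : ℝ[X] →ₗ[ℝ] ℝ) : Prop :=
  ∀ p : ℝ[X], p ≠ 0 → (∀ t ∈ Set.Ioo (0 : ℝ) 1, 0 ≤ p.eval t) → 0 < L p

variable {L : ℝ[X] →ₗ[ℝ] ℝ}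

theorem one_sub_X_ne_zero : (1 - X : ℝ[X]) ≠ 0 := by
  intro h
  have := congrArg (eval 0) h
  simp at this

theorem IsPositive.weighted_sq_pos (hL : IsPositive L) {g h : ℝ[X]} (hg : g ≠ 0) (hh : h ≠ 0)
    (hpos : ∀ t ∈ Set.Ioo (0 : ℝ) 1, 0 ≤ h.eval t) : 0 < L ((1 - X) * (h * (g * g))) := by
  refine hL _ (mul_ne_zero one_sub_X_ne_zero (mul_ne_zero hh (mul_ne_zero hg hg))) fun t ht => ?_
  simp only [eval_mul, eval_sub, eval_one, eval_X]
  exact mul_nonneg (by linarith [ht.2]) (mul_nonneg (hpos t ht) (mul_self_nonneg _))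

/-- The polynomial `q` is orthogonal to all polynomials of smaller degree with respect to
`L ((1 - X) * ·)`. -/
def IsOrthogonal (L : ℝ[X] →ₗ[ℝ] ℝ) (n : ℕ) (q : ℝ[X]) : Prop :=
  ∀ r : ℝ[X], r.degree < n → L ((1 - X) * (q * r)) = 0

/-- The form `L ((1 - X) * (p * r))` is positive definite, hence nondegenerate on polynomials of
degree below `n`. Subtracting from `X ^ n` its projection to that space gives `q`. -/
theorem IsPositive.exists_orthogonal (hL : IsPositive L) (n : ℕ) :
    ∃ q : ℝ[X], q.Monic ∧ q.natDegree = n ∧ IsOrthogonal L n q := by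
  let B : ℝ[X] →ₗ[ℝ] Module.Dual ℝ (degreeLT ℝ n) :=
    LinearMap.mk₂ ℝ (fun (p : ℝ[X]) (r : degreeLT ℝ n) => L ((1 - X) * (p * (r : ℝ[X]))))
      (fun p p' r => by simp [add_mul, mul_add]) (fun c p r => by simp)
      (fun p r r' => by simp [mul_add]) (fun c p r => by simp)
  have hB : ∀ (p : ℝ[X]) (r : degreeLT ℝ n), B p r = L ((1 - X) * (p * (r : ℝ[X]))) :=
    fun p r => rfl
  let B' : degreeLT ℝ n →ₗ[ℝ] Module.Dual ℝ (degreeLT ℝ n) := B ∘ₗ (degreeLT ℝ n).subtype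
  have : FiniteDimensional ℝ (degreeLT ℝ n) :=
    Module.Finite.equiv (degreeLTEquiv ℝ n).symm
  have hinj : Function.Injective B' := by
    rw [← LinearMap.ker_eq_bot, LinearMap.ker_eq_bot']
    intro p hp
    by_contra hne
    have h0 : B' p p = 0 := by rw [hp]; rfl
    have h1 : (p : ℝ[X]) ≠ 0 := fun h => hne (Subtype.ext h)
    have := hL.weighted_sq_pos (h := 1) h1 one_ne_zero (by simp)
    rw [one_mul] at this
    exact this.ne' h0
  have hsurj : Function.Surjective B' :=
    (LinearMap.injective_iff_surjective_of_finrank_eq_finrank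
      (Subspace.dual_finrank_eq).symm).1 hinj
  obtain ⟨p, hp⟩ := hsurj (-(B (X ^ n)))
  have hdeg : (p : ℝ[X]).degree < n := mem_degreeLT.1 p.2
  have hXn : (X ^ n : ℝ[X]).degree = n := degree_X_pow n
  refine ⟨X ^ n + (p : ℝ[X]), monic_X_pow_add hdeg, ?_, fun r hr => ?_⟩
  · refine natDegree_eq_of_degree_eq_some ?_
    rw [degree_add_eq_left_of_degree_lt (by rwa [hXn]), hXn]
  · have := congrArg (fun φ => φ ⟨r, mem_degreeLT.2 hr⟩) hp
    have h2 : B (p : ℝ[X]) ⟨r, mem_degreeLT.2 hr⟩ = -(B (X ^ n) ⟨r, mem_degreeLT.2 hr⟩) := this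
    rw [hB, hB] at h2
    simp only at h2
    rw [add_mul, mul_add, map_add, h2]
    ring

section Roots

variable {n : ℕ} {q : ℝ[X]}

theorem degree_lt_of_mul {h g : ℝ[X]} (hq : q.Monic) (hn : q.natDegree = n) (hqe : q = h * g)
    (hh : 0 < h.natDegree) : g.degree < n := by
  have hne : h * g ≠ 0 := hqe ▸ hq.ne_zero
  have hg : g ≠ 0 := right_ne_zero_of_mul hne
  have := natDegree_mul (left_ne_zero_of_mul hne) hg
  rw [← hqe, hn] at this
  rw [degree_eq_natDegree hg]
  exact_mod_cast (by omega)

/-- A nonconstant factor of an orthogonal polynomial is not nonnegative on `(0, 1)`. -/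
theorem IsOrthogonal.not_nonneg_factor (hL : IsPositive L) (hq : q.Monic) (hn : q.natDegree = n)
    (ho : IsOrthogonal L n q) {h g : ℝ[X]} (hqe : q = h * g) (hh : 0 < h.natDegree) :
    ¬ ∀ t ∈ Set.Ioo (0 : ℝ) 1, 0 ≤ h.eval t := by
  intro hpos
  have hne : h * g ≠ 0 := hqe ▸ hq.ne_zero
  have h1 := hL.weighted_sq_pos (right_ne_zero_of_mul hne) (left_ne_zero_of_mul hne) hpos
  have h2 := ho g (degree_lt_of_mul hq hn hqe hh)
  rw [hqe, mul_assoc] at h2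
  exact h1.ne' h2

theorem IsOrthogonal.root_mem (hL : IsPositive L) (hq : q.Monic) (hn : q.natDegree = n)
    (ho : IsOrthogonal L n q) {r : ℝ} (hr : q.IsRoot r) : r ∈ Set.Ioo (0 : ℝ) 1 := by
  obtain ⟨g, hg⟩ := dvd_iff_isRoot.2 hr
  constructor
  · by_contra! h
    refine ho.not_nonneg_factor hL hq hn hg (by simp) fun t ht => ?_
    simp only [eval_sub, eval_X, eval_C]; linarith [ht.1]
  · by_contra! h
    refine ho.not_nonneg_factor hL hq hn (h := -(X - C r)) (g := -g) (by rw [hg]; ring)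
      (by rw [natDegree_neg]; simp) fun t ht => ?_
    simp only [eval_neg, eval_sub, eval_X, eval_C]; linarith [ht.2]

theorem IsOrthogonal.nodup_roots (hL : IsPositive L) (hq : q.Monic) (hn : q.natDegree = n)
    (ho : IsOrthogonal L n q) : q.roots.Nodup := by
  rw [Multiset.nodup_iff_count_le_one]
  intro r
  rw [count_roots]
  by_contra! h
  obtain ⟨g, hg⟩ := (le_rootMultiplicity_iff hq.ne_zero).1 h
  refine ho.not_nonneg_factor hL hq hn hg (by simp) fun t ht => ?_
  simp only [eval_pow, eval_sub, eval_X, eval_C]; exact sq_nonneg _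

/-- A nonreal root `z` would contribute the real quadratic factor with value `|t - z|²` at `t`,
which is nonnegative. -/
theorem IsOrthogonal.splits (hL : IsPositive L) (hq : q.Monic) (hn : q.natDegree = n)
    (ho : IsOrthogonal L n q) : q.Splits := by
  refine (IsAlgClosed.splits (q.map (algebraMap ℝ ℂ))).of_splits_map _ fun z hz => ?_
  have hzq : aeval z q = 0 := by
    rw [mem_roots (map_ne_zero hq.ne_zero), IsRoot.def, eval_map_algebraMap] at hz
    exact hz
  by_cases him : z.im = 0
  · exact ⟨z.re, by apply Complex.ext <;> simp [him]⟩
  · exfalso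
    obtain ⟨g, hg⟩ := quadratic_dvd_of_aeval_eq_zero_im_ne_zero q hzq him
    have hd : (X ^ 2 - C (2 * z.re) * X + C (‖z‖ ^ 2) : ℝ[X]).natDegree = 2 := by
      compute_degree!
    refine ho.not_nonneg_factor hL hq hn hg (by rw [hd]; norm_num) fun t ht => ?_
    simp only [eval_add, eval_sub, eval_mul, eval_pow, eval_X, eval_C]
    have : ‖z‖ ^ 2 = z.re ^ 2 + z.im ^ 2 := by
      rw [Complex.sq_norm, Complex.normSq_apply]; ring
    rw [this]
    nlinarith [sq_nonneg (t - z.re), sq_nonneg z.im]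

end Roots

/-- **Gauss–Radau quadrature** on `(0, 1)` with the right end point as fixed node: a rule with
`n + 1` distinct nodes and positive weights which is exact up to degree `2 n`. -/
theorem IsPositive.exists_quadrature (hL : IsPositive L) (n : ℕ) :
    ∃ (S : Finset ℝ) (w : ℝ → ℝ), S.card = n ∧ (∀ r ∈ S, r ∈ Set.Ioo (0 : ℝ) 1) ∧
      (∀ r ∈ insert 1 S, 0 < w r) ∧
      ∀ p : ℝ[X], p.natDegree ≤ 2 * n → L p = ∑ r ∈ insert 1 S, w r * p.eval r := by
  obtain ⟨q, hq, hn, ho⟩ := hL.exists_orthogonal n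
  set S : Finset ℝ := q.roots.toFinset with hS
  have hmem : ∀ r, r ∈ S ↔ q.IsRoot r := fun r => by
    rw [hS, Multiset.mem_toFinset, mem_roots hq.ne_zero]
  have hcard : S.card = n := by
    rw [hS, Multiset.toFinset_card_of_nodup (ho.nodup_roots hL hq hn),
      ← (ho.splits hL hq hn).natDegree_eq_card_roots, hn]
  have hS01 : ∀ r ∈ S, r ∈ Set.Ioo (0 : ℝ) 1 := fun r hr =>
    ho.root_mem hL hq hn ((hmem r).1 hr)
  have h1S : (1 : ℝ) ∉ S := fun h => lt_irrefl _ (hS01 1 h).2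
  have hcard' : (insert 1 S).card = n + 1 := by rw [Finset.card_insert_of_notMem h1S, hcard]
  let w : ℝ → ℝ := fun r => L (Lagrange.basis (insert 1 S) id r)
  have hexact : ∀ p : ℝ[X], p.natDegree ≤ 2 * n →
      L p = ∑ r ∈ insert 1 S, w r * p.eval r := by
    intro p hp
    have hm : ((X - 1) * q).Monic := (monic_X_sub_C 1).mul hq
    have hmd : ((X - 1) * q).natDegree = n + 1 := by
      have : (X - 1 : ℝ[X]).Monic := monic_X_sub_C 1
      rw [this.natDegree_mul hq, hn, add_comm]
      congr 1
      exact natDegree_X_sub_C 1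
    set d := p /ₘ ((X - 1) * q) with hd
    set r := p %ₘ ((X - 1) * q) with hr
    have hpd : p = r + ((X - 1) * q) * d := (modByMonic_add_div p ((X - 1) * q)).symm
    have hrdeg : r.degree < (insert 1 S).card := by
      have := degree_modByMonic_lt p hm
      rw [degree_eq_natDegree hm.ne_zero, hmd] at this
      rwa [hcard']
    -- The quotient has degree at most `2 n - (n + 1) = n - 1`, so orthogonality removes it.
    have hLd : L (((X - 1) * q) * d) = 0 := by
      by_cases hd0 : d = 0
      · simp [hd0]
      · have h := ho d (by
          rw [degree_eq_natDegree hd0, hd, natDegree_divByMonic _ hm, hmd]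
          rw [hd] at hd0
          have : ((X - 1) * q).degree ≤ p.degree := by
            by_contra! hlt
            exact hd0 ((divByMonic_eq_zero_iff hm).2 hlt)
          have := natDegree_le_natDegree this
          rw [hmd] at this
          exact_mod_cast (by omega))
        have e : ((X - 1) * q) * d = -((1 - X) * (q * d)) := by ring
        rw [e, map_neg, h, neg_zero]
    have heval : ∀ s ∈ insert 1 S, p.eval s = r.eval s := by
      intro s hs
      rw [hpd]
      rcases Finset.mem_insert.1 hs with rfl | hs
      · simp
      · have := (hmem s).1 hs
        simp [this.eq_zero]
    have hinterp := Lagrange.eq_interpolate (s := insert 1 S) (v := (id : ℝ → ℝ))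
      Function.injective_id.injOn hrdeg
    rw [Finset.sum_congr rfl fun s hs => by rw [heval s hs]]
    conv_lhs => rw [hpd, map_add, hLd, add_zero, hinterp, Lagrange.interpolate_apply, map_sum]
    refine Finset.sum_congr rfl fun s _ => ?_
    rw [← smul_eq_C_mul, map_smul, smul_eq_mul, mul_comm]
    rfl
  -- A weight is positive because exactness can be tested on a polynomial that is nonnegative on
  -- `(0, 1)` and vanishes at all other nodes: `q * q` for the node `1`, and `(1 - X) * g * g` with
  -- `q = (X - s) g` for a root `s`.
  refine ⟨S, w, hcard, hS01, fun s hs => ?_, hexact⟩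
  rcases Finset.mem_insert.1 hs with rfl | hsS
  · have hpos : 0 < L (q * q) := hL _ (mul_ne_zero hq.ne_zero hq.ne_zero) fun t _ => by
      rw [eval_mul]; exact mul_self_nonneg _
    rw [hexact _ (by rw [hq.natDegree_mul hq, hn]; omega), Finset.sum_insert h1S,
      Finset.sum_eq_zero fun r hr => by simp [((hmem r).1 hr).eq_zero], add_zero, eval_mul] at hpos
    exact pos_of_mul_pos_left hpos (mul_self_nonneg _)
  · obtain ⟨g, hg⟩ := dvd_iff_isRoot.2 ((hmem s).1 hsS)
    have hg0 : g ≠ 0 := by rintro rfl; exact hq.ne_zero (by rw [hg, mul_zero])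
    have hgd : g.natDegree + 1 = n := by
      rw [← hn, hg, natDegree_mul (X_sub_C_ne_zero s) hg0, natDegree_X_sub_C, add_comm]
    have hpos := hL.weighted_sq_pos (h := 1) hg0 one_ne_zero (by simp)
    have hdeg : ((1 - X) * (1 * (g * g))).natDegree ≤ 2 * n := by
      have e1 : (1 - X : ℝ[X]).natDegree ≤ 1 := by compute_degree
      have := natDegree_mul_le (p := (1 - X : ℝ[X])) (q := 1 * (g * g))
      have e2 : (1 * (g * g)).natDegree ≤ g.natDegree + g.natDegree := by
        rw [one_mul]; exact natDegree_mul_le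
      omega
    rw [hexact _ hdeg, Finset.sum_eq_single_of_mem s hs] at hpos
    · refine pos_of_mul_pos_left hpos ?_
      simp only [eval_mul, eval_sub, eval_one, eval_X, one_mul]
      exact mul_nonneg (by linarith [(hS01 s hsS).2]) (mul_self_nonneg _)
    · intro r hr hrs
      rcases Finset.mem_insert.1 hr with rfl | hr
      · simp
      · have h0 := ((hmem r).1 hr).eq_zero
        rw [hg, eval_mul, eval_sub, eval_X, eval_C] at h0
        rcases mul_eq_zero.1 h0 with h | h
        · exact absurd (sub_eq_zero.1 h) hrs
        · simp [h]

/-! ### The interpolating majorant. -/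

/-- A polynomial of degree at most `2 n` which majorizes `t ↦ (x - 1) / ((1 - t) x + t)` on `(0, 1)`
and interpolates it at `1` and, to second order, at the points of `S`. -/
theorem exists_majorant (S : Finset ℝ) {x : ℝ} (hx : 0 < x)
    (hS : ∀ r ∈ S, r ∈ Set.Ioo (0 : ℝ) 1) :
    ∃ p : ℝ[X], p.natDegree ≤ 2 * S.card ∧
      (∀ t ∈ Set.Ioo (0 : ℝ) 1, (x - 1) / ((1 - t) * x + t) ≤ p.eval t) ∧
      ∀ r ∈ insert 1 S, p.eval r = (x - 1) / ((1 - r) * x + r) := by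
  rcases eq_or_ne x 1 with rfl | hx1
  · exact ⟨0, by simp⟩
  have hx1' : x - 1 ≠ 0 := sub_ne_zero.2 hx1
  -- In this parameter the function is `t ↦ (c - t)⁻¹`, with its pole `c` outside `(0, 1]`.
  set c := x / (x - 1) with hc
  have hden : ∀ t : ℝ, t ∈ Set.Ioc (0 : ℝ) 1 → 0 < (1 - t) * x + t := fun t ht => by
    nlinarith [ht.1, mul_nonneg (sub_nonneg.2 ht.2) hx.le]
  have hct : ∀ t : ℝ, c - t = ((1 - t) * x + t) / (x - 1) := fun t => by
    rw [hc]; field_simp; ring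
  have hfrac : ∀ t : ℝ, (x - 1) / ((1 - t) * x + t) = (c - t)⁻¹ := fun t => by
    rw [hct, inv_div]
  have hct0 : ∀ t : ℝ, t ∈ Set.Ioc (0 : ℝ) 1 → c - t ≠ 0 := fun t ht => by
    rw [hct]; exact div_ne_zero (hden t ht).ne' hx1'
  set q : ℝ[X] := Lagrange.nodal S id with hq
  have hqm : q.Monic := Lagrange.nodal_monic
  set N : ℝ[X] := (1 - X) * (q * q) with hN
  have hNdeg : N.natDegree = 2 * S.card + 1 := by
    have e1 : (1 - X : ℝ[X]).natDegree = 1 := by compute_degree!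
    rw [hN, natDegree_mul one_sub_X_ne_zero (mul_ne_zero hqm.ne_zero hqm.ne_zero), e1,
      hqm.natDegree_mul hqm, hq, Lagrange.natDegree_nodal]
    omega
  have hNr : ∀ r ∈ insert 1 S, N.eval r = 0 := by
    intro r hr
    rcases Finset.mem_insert.1 hr with rfl | hr
    · simp [hN]
    · have : q.eval r = 0 := Lagrange.eval_nodal_at_node (v := (id : ℝ → ℝ)) hr
      simp [hN, this]
  have hqc : q.eval c ≠ 0 := by
    rw [hq, Lagrange.eval_nodal, Finset.prod_ne_zero_iff]
    exact fun r hr => hct0 r ⟨(hS r hr).1, (hS r hr).2.le⟩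
  have hNc : N.eval c = (1 - c) * (q.eval c * q.eval c) := by simp [hN]
  have h1c : 1 - c = -(x - 1)⁻¹ := by rw [hc]; field_simp; ring
  have hNc0 : N.eval c ≠ 0 := by
    rw [hNc, h1c]
    exact mul_ne_zero (neg_ne_zero.2 (inv_ne_zero hx1')) (mul_ne_zero hqc hqc)
  -- The interpolant is `(N(c) - N(t)) / (N(c) (c - t))`, a polynomial since the numerator vanishes
  -- at `c`. It differs from `(c - t)⁻¹` by `N(t) / (N(c) (c - t))`.
  set D := N /ₘ (X - C c) with hD
  have hDN : ∀ t, N.eval t = (t - c) * D.eval t + N.eval c := by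
    intro t
    conv_lhs => rw [← modByMonic_add_div N (X - C c), modByMonic_X_sub_C_eq_C_eval]
    simp only [eval_add, eval_C, eval_mul, eval_sub, eval_X]
    ring
  have hDt : ∀ t, t ∈ Set.Ioc (0 : ℝ) 1 →
      (C (N.eval c)⁻¹ * D).eval t = (c - t)⁻¹ - N.eval t / (N.eval c * (c - t)) := by
    intro t ht
    have h1 := hct0 t ht
    rw [hDN t, eval_mul, eval_C]
    field_simp
    ring
  refine ⟨C (N.eval c)⁻¹ * D, ?_, fun t ht => ?_, fun r hr => ?_⟩
  · refine (natDegree_C_mul_le _ _).trans ?_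
    rw [hD, natDegree_divByMonic _ (monic_X_sub_C c), hNdeg, natDegree_X_sub_C]
    omega
  · have ht' : t ∈ Set.Ioc (0 : ℝ) 1 := ⟨ht.1, ht.2.le⟩
    rw [hDt t ht', hfrac]
    have hNt : 0 ≤ N.eval t := by
      simp only [hN, eval_mul, eval_sub, eval_one, eval_X]
      exact mul_nonneg (by linarith [ht.2]) (mul_self_nonneg _)
    -- The node `1` puts the factor `1 - c = -1 / (x - 1)` into `N(c)`, which offsets the sign of `c
    -- - t`. The error therefore has the same sign for `x < 1` and `x > 1`.
    have hneg : N.eval c * (c - t) ≤ 0 := by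
      rw [hNc, hct, h1c]
      have : -(x - 1)⁻¹ * (eval c q * eval c q) * (((1 - t) * x + t) / (x - 1)) =
          -((x - 1)⁻¹ ^ 2 * (eval c q * eval c q) * ((1 - t) * x + t)) := by
        field_simp
      rw [this, neg_nonpos]
      exact mul_nonneg (mul_nonneg (sq_nonneg _) (mul_self_nonneg _)) (hden t ht').le
    linarith [div_nonpos_of_nonneg_of_nonpos hNt hneg]
  · have hr' : r ∈ Set.Ioc (0 : ℝ) 1 := by
      rcases Finset.mem_insert.1 hr with rfl | hr
      · simp
      · exact ⟨(hS r hr).1, (hS r hr).2.le⟩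
    rw [hDt r hr', hNr r hr, hfrac]
    simp

/-! ### The weight function and the bound for real powers. -/

/-- The density `s ^ β / (1 + s) ^ 2`; under `t = s / (1 + s)` it becomes `t ^ β (1 - t) ^ (-β)`. -/
noncomputable def density (β s : ℝ) : ℝ := s ^ β / (1 + s) ^ 2

variable {β : ℝ}

theorem density_pos {s : ℝ} (hs : s ∈ Set.Ioi (0 : ℝ)) : 0 < density β s := by
  have : (0 : ℝ) < s := hs
  unfold density
  positivity

theorem div_one_add_mem {s : ℝ} (hs : s ∈ Set.Ioi (0 : ℝ)) : s / (1 + s) ∈ Set.Ioo (0 : ℝ) 1 := by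
  have : (0 : ℝ) < s := hs
  exact ⟨by positivity, by rw [div_lt_one (by positivity)]; linarith⟩

/-- Subtracting the value at `1` turns the integral representation of `x ^ β` into one over `t = s /
(1 + s)` with a kernel that stays bounded on `(0, 1)`. -/
theorem rpowIntegrand_sub {s x : ℝ} (hs : s ∈ Set.Ioi (0 : ℝ)) (hx : 0 < x) :
    Real.rpowIntegrand₀₁ β s x - Real.rpowIntegrand₀₁ β s 1 =
      (x - 1) / ((1 - s / (1 + s)) * x + s / (1 + s)) * density β s := by
  have h0 : (0 : ℝ) < s := hs
  have e : (1 - s / (1 + s)) * x + s / (1 + s) = (s + x) / (1 + s) := by field_simp; ring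
  rw [e]
  unfold Real.rpowIntegrand₀₁ density
  field_simp
  ring

theorem measurable_density : Measurable (density β) := by
  unfold density; fun_prop

theorem integrableOn_density (hβ : β ∈ Set.Ioo (0 : ℝ) 1) :
    IntegrableOn (density β) (Set.Ioi 0) := by
  -- At `x = 2` the kernel is `1 / (2 - t) ≥ 1 / 2`, so twice the difference of integrands dominates
  -- the density.
  have h := ((Real.integrableOn_rpowIntegrand₀₁_Ioi hβ (x := 2) (by norm_num)).sub
    (Real.integrableOn_rpowIntegrand₀₁_Ioi hβ (x := 1) zero_le_one)).const_mul 2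
  refine Integrable.mono' h measurable_density.aestronglyMeasurable ?_
  refine ae_restrict_of_forall_mem measurableSet_Ioi fun s hs => ?_
  rw [Real.norm_of_nonneg (density_pos hs).le, Pi.sub_apply, rpowIntegrand_sub hs two_pos,
    ← mul_assoc]
  refine le_mul_of_one_le_left (density_pos hs).le ?_
  have := div_one_add_mem hs
  have h3 : 0 < (1 - s / (1 + s)) * 2 + s / (1 + s) := by linarith [this.1, this.2]
  rw [← mul_div_assoc, le_div_iff₀ h3]
  linarith [this.1]

theorem integrableOn_poly (hβ : β ∈ Set.Ioo (0 : ℝ) 1) (p : ℝ[X]) :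
    IntegrableOn (fun s => p.eval (s / (1 + s)) * density β s) (Set.Ioi 0) := by
  obtain ⟨K, hK⟩ := (isCompact_Icc (a := (0 : ℝ)) (b := 1)).exists_bound_of_continuousOn
    p.continuous.continuousOn
  refine Integrable.mono' ((integrableOn_density hβ).const_mul K) ?_ ?_
  · exact ((p.continuous.measurable.comp (by fun_prop)).mul measurable_density).aestronglyMeasurable
  · refine ae_restrict_of_forall_mem measurableSet_Ioi fun s hs => ?_
    rw [norm_mul, Real.norm_of_nonneg (density_pos hs).le]
    exact mul_le_mul_of_nonneg_right (hK _ (Set.Ioo_subset_Icc_self (div_one_add_mem hs)))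
      (density_pos hs).le

/-- Integration of a polynomial against `t ^ β (1 - t) ^ (-β)` on `(0, 1)`. -/
noncomputable def functional (hβ : β ∈ Set.Ioo (0 : ℝ) 1) : ℝ[X] →ₗ[ℝ] ℝ where
  toFun p := ∫ s in Set.Ioi (0 : ℝ), p.eval (s / (1 + s)) * density β s
  map_add' p q := by
    rw [← integral_add (integrableOn_poly hβ p) (integrableOn_poly hβ q)]
    simp only [eval_add, add_mul]
  map_smul' c p := by
    simp only [eval_smul, smul_eq_mul, mul_assoc, RingHom.id_apply]
    rw [integral_const_mul]

/-- Strictness holds because the integrand vanishes only where `s / (1 + s)` is a root of `p`, a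
finite set by injectivity. -/
theorem functional_isPositive (hβ : β ∈ Set.Ioo (0 : ℝ) 1) : IsPositive (functional hβ) := by
  intro p hp hpos
  have hnn : ∀ s ∈ Set.Ioi (0 : ℝ), 0 ≤ p.eval (s / (1 + s)) * density β s := fun s hs =>
    mul_nonneg (hpos _ (div_one_add_mem hs)) (density_pos hs).le
  change 0 < ∫ s in Set.Ioi (0 : ℝ), p.eval (s / (1 + s)) * density β s
  rw [setIntegral_pos_iff_support_of_nonneg_ae
    (ae_restrict_of_forall_mem measurableSet_Ioi hnn) (integrableOn_poly hβ p)]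
  let Z : Set ℝ := (fun s : ℝ => s / (1 + s)) ⁻¹' (p.roots.toFinset : Set ℝ) ∩ Set.Ioi 0
  have hZ : Z.Finite := by
    refine Set.Finite.of_finite_image (f := fun s : ℝ => s / (1 + s))
      (p.roots.toFinset.finite_toSet.subset ?_) ?_
    · rintro _ ⟨s, hs, rfl⟩
      exact hs.1
    · intro a ha b hb hab
      have ha0 : (0 : ℝ) < a := ha.2
      have hb0 : (0 : ℝ) < b := hb.2
      simp only at hab
      rw [div_eq_div_iff (by positivity) (by positivity)] at hab
      linarith
  have hsub : Set.Ioi (0 : ℝ) \ Z ⊆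
      Function.support (fun s => p.eval (s / (1 + s)) * density β s) ∩ Set.Ioi 0 := by
    rintro s ⟨hs, hsZ⟩
    refine ⟨?_, hs⟩
    rw [Function.mem_support]
    refine mul_ne_zero (fun h => hsZ ⟨?_, hs⟩) (density_pos hs).ne'
    simp only [Set.mem_preimage, Finset.mem_coe, Multiset.mem_toFinset]
    exact (mem_roots hp).2 h
  refine lt_of_lt_of_le ?_ (measure_mono hsub)
  rw [measure_sdiff_null (hZ.measure_zero volume), Real.volume_Ioi]
  exact ENNReal.zero_lt_top

/-- The function `x ↦ x ^ β`, `0 < β < 1`, is majorized by its `n + 1` point Gauss–Radau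
discretization, for a rule with fixed node `1`. -/
theorem exists_rpow_le (hβ : β ∈ Set.Ioo (0 : ℝ) 1) (n : ℕ) :
    ∃ s v : Fin (n + 1) → ℝ, Function.Injective s ∧ (∀ i, s i ∈ Set.Ioc (0 : ℝ) 1) ∧
      (∀ i, 0 < v i) ∧ ∀ x : ℝ, 0 < x →
        x ^ β ≤ 1 + ∑ i, v i * ((x - 1) / ((1 - s i) * x + s i)) := by
  obtain ⟨S, w, hcard, hS, hw, hexact⟩ := (functional_isPositive hβ).exists_quadrature n
  have h1S : (1 : ℝ) ∉ S := fun h => lt_irrefl _ (hS 1 h).2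
  have hcard' : (insert 1 S).card = n + 1 := by rw [Finset.card_insert_of_notMem h1S, hcard]
  let e := (Finset.equivFinOfCardEq hcard').symm
  set K := (∫ t in Set.Ioi (0 : ℝ), Real.rpowIntegrand₀₁ β t 1)⁻¹ with hKdef
  have hK : 0 < K := inv_pos.2 (Real.integral_rpowIntegrand₀₁_one_pos hβ)
  refine ⟨fun i => e i, fun i => K * w (e i), Subtype.val_injective.comp e.injective, fun i => ?_,
    fun i => mul_pos hK (hw _ (e i).2), fun x hx => ?_⟩
  · rcases Finset.mem_insert.1 (e i).2 with h | h
    · simp [h]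
    · exact ⟨(hS _ h).1, (hS _ h).2.le⟩
  · obtain ⟨p, hpd, hple, hpeq⟩ := exists_majorant S hx hS
    have hint := (Real.integrableOn_rpowIntegrand₀₁_Ioi hβ (x := x) hx.le).sub
      (Real.integrableOn_rpowIntegrand₀₁_Ioi hβ (x := 1) zero_le_one)
    have h1 : x ^ β - 1 = K * ∫ s in Set.Ioi (0 : ℝ),
        (Real.rpowIntegrand₀₁ β s x - Real.rpowIntegrand₀₁ β s 1) := by
      rw [integral_sub (Real.integrableOn_rpowIntegrand₀₁_Ioi hβ hx.le)
        (Real.integrableOn_rpowIntegrand₀₁_Ioi hβ zero_le_one), mul_sub,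
        ← Real.rpow_eq_const_mul_integral hβ hx.le, ← Real.rpow_eq_const_mul_integral hβ zero_le_one,
        Real.one_rpow]
    have h2 : ∫ s in Set.Ioi (0 : ℝ),
        (Real.rpowIntegrand₀₁ β s x - Real.rpowIntegrand₀₁ β s 1) ≤ functional hβ p := by
      refine setIntegral_mono_on hint (integrableOn_poly hβ p) measurableSet_Ioi fun s hs => ?_
      rw [rpowIntegrand_sub hs hx]
      exact mul_le_mul_of_nonneg_right (hple _ (div_one_add_mem hs)) (density_pos hs).le
    have h3 : functional hβ p = ∑ i, w (e i) * ((x - 1) / ((1 - (e i : ℝ)) * x + e i)) := by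
      rw [hexact p (by rwa [hcard] at hpd),
        Finset.sum_congr rfl fun r hr => by rw [hpeq r hr],
        ← Finset.sum_coe_sort (insert 1 S) fun r => w r * ((x - 1) / ((1 - r) * x + r))]
      exact (Equiv.sum_comp e fun r : {r // r ∈ insert 1 S} =>
        w r * ((x - 1) / ((1 - (r : ℝ)) * x + r))).symm
    have h4 : x ^ β - 1 ≤ K * functional hβ p := by
      rw [h1]; exact mul_le_mul_of_nonneg_left h2 hK.le
    rw [h3, Finset.mul_sum] at h4
    simp only [mul_assoc]
    linarith

end GaussRadau

/-! ### Powers of Hermitian matrices. -/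

namespace RenyiDI

theorem isHermitian_blockDiagonal {n o : Type*} [DecidableEq o] {M : o → Matrix n n ℂ}
    (hM : ∀ i, (M i).IsHermitian) : (Matrix.blockDiagonal M).IsHermitian := by
  rw [Matrix.IsHermitian, Matrix.blockDiagonal_conjTranspose]
  exact congrArg _ (funext hM)

section Power

variable {n o : Type*} [Fintype n] [DecidableEq n] [Fintype o] [DecidableEq o]

theorem finite_real_spectrum {A : Matrix n n ℂ} (hA : A.IsHermitian) :
    (spectrum ℝ A).Finite := by
  rw [hA.spectrum_real_eq_range_eigenvalues]
  exact Set.finite_range _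

theorem cfc_eq_aeval {A : Matrix n n ℂ} (hA : A.IsHermitian) {f : ℝ → ℝ} {p : Polynomial ℝ}
    (h : ∀ r ∈ spectrum ℝ A, p.eval r = f r) : cfc f A = Polynomial.aeval A p := by
  rw [← cfc_polynomial p A hA]
  exact cfc_congr fun _ hr => (h _ hr).symm

theorem exists_polynomial_eval_eq {T : Set ℝ} (hT : T.Finite) (f : ℝ → ℝ) :
    ∃ p : Polynomial ℝ, ∀ r ∈ T, p.eval r = f r :=
  ⟨Lagrange.interpolate hT.toFinset id f, fun _ hr =>
    Lagrange.eval_interpolate_at_node (v := (id : ℝ → ℝ)) f Function.injective_id.injOn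
      (hT.mem_toFinset.2 hr)⟩

/-- `Matrix.blockDiagonal` as a homomorphism of real algebras. -/
noncomputable def blockDiagonalAlgHom (n o : Type*) [Fintype n] [DecidableEq n] [Fintype o]
    [DecidableEq o] :
    (o → Matrix n n ℂ) →ₐ[ℝ] Matrix (n × o) (n × o) ℂ :=
  AlgHom.mk' (Matrix.blockDiagonalRingHom n o ℂ) fun c M => Matrix.blockDiagonal_smul c M

/-- All spectra involved are finite, so a single interpolating polynomial computes every power, and
polynomials commute with algebra homomorphisms. This also handles negative powers on the support,
where `r ^ s` is discontinuous at `0`. -/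
theorem mpow_blockDiagonal {M : o → Matrix n n ℂ} (hM : ∀ i, (M i).IsHermitian) (s : ℝ) :
    mpow (Matrix.blockDiagonal M) s = Matrix.blockDiagonal fun i => mpow (M i) s := by
  obtain ⟨p, hp⟩ := exists_polynomial_eval_eq
    ((finite_real_spectrum (isHermitian_blockDiagonal hM)).union
      (Set.finite_iUnion fun i => finite_real_spectrum (hM i))) fun r : ℝ => r ^ s
  have h1 := cfc_eq_aeval (isHermitian_blockDiagonal hM) fun r hr => hp r (Or.inl hr)
  have h2 : ∀ i, mpow (M i) s = Polynomial.aeval (M i) p := fun i =>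
    cfc_eq_aeval (hM i) fun r hr => hp r (Or.inr (Set.mem_iUnion.2 ⟨i, hr⟩))
  rw [mpow, h1]
  change Polynomial.aeval (blockDiagonalAlgHom n o M) p =
    blockDiagonalAlgHom n o fun i => mpow (M i) s
  rw [Polynomial.aeval_algHom_apply]
  refine congrArg _ (funext fun i => ?_)
  rw [h2]
  exact (Polynomial.aeval_algHom_apply (Pi.evalAlgHom ℝ (fun _ : o => Matrix n n ℂ) i) M p).symm

theorem mpow_reindex {A : Matrix n n ℂ} (hA : A.IsHermitian) (e : n ≃ o) (s : ℝ) :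
    mpow (Matrix.reindex e e A) s = Matrix.reindex e e (mpow A s) := by
  have hB : (Matrix.reindex e e A).IsHermitian := hA.submatrix _
  obtain ⟨p, hp⟩ := exists_polynomial_eval_eq
    ((finite_real_spectrum hA).union (finite_real_spectrum hB)) fun r : ℝ => r ^ s
  rw [mpow, mpow, cfc_eq_aeval hA fun r hr => hp r (Or.inl hr),
    cfc_eq_aeval hB fun r hr => hp r (Or.inr hr)]
  exact Polynomial.aeval_algHom_apply (Matrix.reindexAlgEquiv ℝ ℂ e).toAlgHom A p

theorem mpow_smul {A : Matrix n n ℂ} (hA : A.PosSemidef) {c : ℝ} (hc : 0 ≤ c) (s : ℝ) :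
    mpow (c • A) s = c ^ s • mpow A s := by
  have hfin := finite_real_spectrum hA.1
  have hcont : ∀ f : ℝ → ℝ, ContinuousOn f (spectrum ℝ A) := fun f => hfin.continuousOn f
  have h1 : mpow (c • A) s = cfc (fun r : ℝ => (c • r) ^ s) A :=
    (cfc_comp_smul c (fun r : ℝ => r ^ s) A ((hfin.image _).continuousOn _) hA.1).symm
  have h2 : c ^ s • mpow A s = cfc (fun r : ℝ => c ^ s • r ^ s) A :=
    (cfc_smul (c ^ s) (fun r : ℝ => r ^ s) A (hcont _)).symm
  rw [h1, h2]
  refine cfc_congr fun r hr => ?_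
  rw [hA.1.spectrum_real_eq_range_eigenvalues] at hr
  obtain ⟨i, rfl⟩ := hr
  simp only [smul_eq_mul]
  exact Real.mul_rpow hc (hA.eigenvalues_nonneg i)

theorem mpow_zero {s : ℝ} (hs : s ≠ 0) : mpow (0 : Matrix n n ℂ) s = 0 := by
  have h := mpow_smul (Matrix.PosSemidef.zero (n := n) (R := ℂ)) le_rfl s
  rwa [Real.zero_rpow hs, zero_smul, zero_smul] at h

/-- The spectral decomposition, together with that of the powers. -/
theorem exists_spectral {A : Matrix n n ℂ} (hA : A.PosSemidef) :
    ∃ (U : Matrix n n ℂ) (d : n → ℝ), Uᴴ * U = 1 ∧ U * Uᴴ = 1 ∧ (∀ i, 0 ≤ d i) ∧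
      A = U * Matrix.diagonal (fun i => (d i : ℂ)) * Uᴴ ∧
      ∀ s : ℝ, mpow A s = U * Matrix.diagonal (fun i => ((d i ^ s : ℝ) : ℂ)) * Uᴴ := by
  refine ⟨hA.1.eigenvectorUnitary, hA.1.eigenvalues, ?_, ?_, hA.eigenvalues_nonneg, ?_, fun s => ?_⟩
  · exact Unitary.coe_star_mul_self _
  · exact Unitary.coe_mul_star_self _
  · exact hA.1.spectral_theorem
  · rw [mpow, hA.1.cfc_eq]
    rfl

end Power

/-! ### The trace inequality for one pair `ρ ≤ τ`. -/

section TraceBound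

variable {e : Type*} [Fintype e]

/-- `Tr[ρ (1 + Z + Z† + (1 - t) Z† Z)] + t Tr[τ Z Z†]`. -/
noncomputable def nodeTerm [DecidableEq e] (ρ τ : Matrix e e ℂ) (t : ℝ) (Z : Matrix e e ℂ) : ℝ :=
  ((ρ * (1 + Z + Zᴴ + (1 - t) • (Zᴴ * Z))).trace + t • (τ * (Z * Zᴴ)).trace).re

theorem re_trace_polyP_add_polyQ [DecidableEq e] (ρ τ : Matrix e e ℂ) (α : ℝ) {m : ℕ}
    (s w : Fin m → ℝ) (hs : ∀ i, s i ≠ 0) (Z : Fin m → Matrix e e ℂ) :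
    (ρ * polyP α s w Z).trace.re + (τ * polyQ α w Z).trace.re =
      ρ.trace.re + Real.sin (α * Real.pi) / Real.pi *
        ∑ i, w i / s i * nodeTerm ρ τ (s i) (Z i) := by
  have h1 : (ρ * polyP α s w Z).trace.re = ρ.trace.re + Real.sin (α * Real.pi) / Real.pi *
      ∑ i, w i / s i * (ρ * (1 + Z i + (Z i)ᴴ + (1 - s i) • ((Z i)ᴴ * Z i))).trace.re := by
    rw [polyP, mul_add, mul_one, Matrix.trace_add, Complex.add_re, mul_smul_comm,
      Matrix.trace_smul, Complex.smul_re, Finset.mul_sum, Matrix.trace_sum, Complex.re_sum]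
    simp only [mul_smul_comm _ ρ, Matrix.trace_smul, Complex.smul_re, smul_eq_mul]
  have h2 : (τ * polyQ α w Z).trace.re = Real.sin (α * Real.pi) / Real.pi *
      ∑ i, w i / s i * (s i * (τ * (Z i * (Z i)ᴴ)).trace.re) := by
    rw [polyQ, mul_smul_comm, Matrix.trace_smul, Complex.smul_re, Finset.mul_sum,
      Matrix.trace_sum, Complex.re_sum, smul_eq_mul]
    congr 1
    refine Finset.sum_congr rfl fun i _ => ?_
    rw [mul_smul_comm, Matrix.trace_smul, Complex.smul_re, smul_eq_mul]
    have := hs i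
    field_simp
  rw [h1, h2, add_assoc, ← mul_add, ← Finset.sum_add_distrib]
  congr 2
  refine Finset.sum_congr rfl fun i _ => ?_
  rw [nodeTerm, Complex.add_re, Complex.smul_re, smul_eq_mul]
  ring

theorem trace_mul_mul_conjTranspose_nonneg {ρ : Matrix e e ℂ} (hρ : ρ.PosSemidef)
    (Z : Matrix e e ℂ) : 0 ≤ (ρ * (Z * Zᴴ)).trace.re := by
  have h := (hρ.conjTranspose_mul_mul_same Z).trace_nonneg
  rw [Matrix.trace_mul_cycle, Matrix.trace_mul_comm] at h
  exact (Complex.nonneg_iff.1 h).1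

/-- With `W = 1 + Z`, the term equals `(1 - t) Tr[ρ W† W] + t (Tr[ρ W W†] + Tr[(τ - ρ) Z Z†])`. This
gives both the finiteness of the supremum and the case `m = 0`. -/
theorem nodeTerm_nonneg [DecidableEq e] {ρ τ : Matrix e e ℂ} (hρ : ρ.PosSemidef)
    (hτ : (τ - ρ).PosSemidef) {t : ℝ} (ht : t ∈ Set.Ioc (0 : ℝ) 1) (Z : Matrix e e ℂ) :
    0 ≤ nodeTerm ρ τ t Z := by
  have h1 := trace_mul_mul_conjTranspose_nonneg hρ (1 + Z)ᴴ
  have h2 := trace_mul_mul_conjTranspose_nonneg hρ (1 + Z)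
  have h3 := trace_mul_mul_conjTranspose_nonneg hτ Z
  have h4 : nodeTerm ρ τ t Z = (1 - t) * (ρ * ((1 + Z)ᴴ * (1 + Z)ᴴᴴ)).trace.re +
      t * ((ρ * ((1 + Z) * (1 + Z)ᴴ)).trace.re + ((τ - ρ) * (Z * Zᴴ)).trace.re) := by
    simp only [nodeTerm, Matrix.conjTranspose_add, Matrix.conjTranspose_one,
      Matrix.conjTranspose_conjTranspose, mul_add, add_mul, mul_one, one_mul, sub_mul,
      Matrix.trace_add, Matrix.trace_sub, Complex.add_re, Complex.sub_re, mul_smul_comm,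
      Matrix.trace_smul, Complex.smul_re, smul_eq_mul]
    ring
  rw [h4]
  exact add_nonneg (mul_nonneg (by linarith [ht.2]) h1)
    (mul_nonneg ht.1.le (add_nonneg h2 h3))

variable [DecidableEq e] {U V : Matrix e e ℂ} {lam mu : e → ℝ}

theorem trace_diagonal_mul_conjTranspose_mul (d : e → ℂ) (G Y : Matrix e e ℂ) :
    (Matrix.diagonal d * (Gᴴ * Y)).trace = ∑ i, ∑ j, d i * (star (G j i) * Y j i) := by
  simp only [Matrix.trace, Matrix.diag, Matrix.diagonal_mul, Matrix.mul_apply (M := Gᴴ),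
    Matrix.conjTranspose_apply, Finset.mul_sum]

theorem star_mul_self_eq_normSq (z : ℂ) : star z * z = (Complex.normSq z : ℂ) := by
  rw [Complex.normSq_eq_conj_mul_self]; rfl

theorem trace_spectral_mul (a b : e → ℝ) :
    (U * Matrix.diagonal (fun i => (a i : ℂ)) * Uᴴ *
      (V * Matrix.diagonal (fun j => (b j : ℂ)) * Vᴴ)).trace =
      ((∑ i, ∑ j, a i * b j * Complex.normSq ((Vᴴ * U) j i) : ℝ) : ℂ) := by
  have h : (U * Matrix.diagonal (fun i => (a i : ℂ)) * Uᴴ *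
      (V * Matrix.diagonal (fun j => (b j : ℂ)) * Vᴴ)).trace =
      (Matrix.diagonal (fun i => (a i : ℂ)) *
        ((Vᴴ * U)ᴴ * (Matrix.diagonal (fun j => (b j : ℂ)) * (Vᴴ * U)))).trace := by
    rw [mul_assoc, mul_assoc, Matrix.trace_mul_comm]
    simp only [mul_assoc, Matrix.conjTranspose_mul, Matrix.conjTranspose_conjTranspose]
  rw [h, trace_diagonal_mul_conjTranspose_mul]
  push_cast
  refine Finset.sum_congr rfl fun i _ => Finset.sum_congr rfl fun j _ => ?_
  rw [Matrix.diagonal_mul, ← star_mul_self_eq_normSq]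
  ring

/-- The value of `nodeTerm` at the operator with matrix elements `z i j ⟨v_j, u_i⟩` between the
eigenbases of `ρ` and `τ`. -/
theorem nodeTerm_spectral (hU : Uᴴ * U = 1) (hV : Vᴴ * V = 1)
    (hV' : V * Vᴴ = 1) (t : ℝ) (z : e → e → ℝ) :
    nodeTerm (U * Matrix.diagonal (fun i => (lam i : ℂ)) * Uᴴ)
      (V * Matrix.diagonal (fun j => (mu j : ℂ)) * Vᴴ) t
      (V * Matrix.of (fun j i => (z i j : ℂ) * (Vᴴ * U) j i) * Uᴴ) =
    ∑ i, ∑ j, (lam i + 2 * lam i * z i j + ((1 - t) * lam i + t * mu j) * z i j ^ 2) *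
      Complex.normSq ((Vᴴ * U) j i) := by
  set G := Vᴴ * U with hG
  set Y : Matrix e e ℂ := Matrix.of (fun j i => (z i j : ℂ) * G j i) with hY
  set Λ := Matrix.diagonal (fun i => (lam i : ℂ)) with hΛ
  set Δ := Matrix.diagonal (fun j => (mu j : ℂ)) with hΔ
  have hGG : Gᴴ * G = 1 := by
    rw [hG, Matrix.conjTranspose_mul, Matrix.conjTranspose_conjTranspose, mul_assoc,
      ← mul_assoc V, hV', one_mul, hU]
  have h0 : (U * Λ * Uᴴ).trace.re = ∑ i, ∑ j, lam i * Complex.normSq (G j i) := by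
    have : (U * Λ * Uᴴ).trace = (Λ * (Gᴴ * G)).trace := by
      rw [Matrix.trace_mul_comm, ← mul_assoc, hU, one_mul, hGG, mul_one]
    rw [this, trace_diagonal_mul_conjTranspose_mul]
    simp only [star_mul_self_eq_normSq, Complex.re_sum, ← Complex.ofReal_mul, Complex.ofReal_re]
  have h1 : (U * Λ * Uᴴ * (V * Y * Uᴴ)).trace.re =
      ∑ i, ∑ j, lam i * z i j * Complex.normSq (G j i) := by
    have : (U * Λ * Uᴴ * (V * Y * Uᴴ)).trace = (Λ * (Gᴴ * Y)).trace := by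
      rw [← mul_assoc, Matrix.trace_mul_comm, hG, Matrix.conjTranspose_mul,
        Matrix.conjTranspose_conjTranspose]
      simp only [← mul_assoc]
      rw [hU, one_mul]
    rw [this, trace_diagonal_mul_conjTranspose_mul, Complex.re_sum]
    refine Finset.sum_congr rfl fun i _ => ?_
    rw [Complex.re_sum]
    refine Finset.sum_congr rfl fun j _ => ?_
    rw [hY, Matrix.of_apply, mul_left_comm (star _), star_mul_self_eq_normSq]
    simp only [← Complex.ofReal_mul, Complex.ofReal_re]
    ring
  have h2 : (U * Λ * Uᴴ * (V * Y * Uᴴ)ᴴ).trace.re =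
      ∑ i, ∑ j, lam i * z i j * Complex.normSq (G j i) := by
    have hh : (U * Λ * Uᴴ)ᴴ = U * Λ * Uᴴ := by
      have : Λᴴ = Λ := by
        rw [hΛ, Matrix.diagonal_conjTranspose]
        exact congrArg _ (funext fun i => Complex.conj_ofReal _)
      simp only [Matrix.conjTranspose_mul, Matrix.conjTranspose_conjTranspose, this, mul_assoc]
    rw [← h1, Matrix.trace_mul_comm, ← hh, ← Matrix.conjTranspose_mul,
      Matrix.trace_conjTranspose, hh]
    exact Complex.conj_re _
  have hnorm : ∀ i j, star (Y j i) * Y j i = ((z i j ^ 2 * Complex.normSq (G j i) : ℝ) : ℂ) := by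
    intro i j
    rw [star_mul_self_eq_normSq, hY, Matrix.of_apply, Complex.normSq_mul, Complex.normSq_ofReal]
    push_cast
    ring
  have h3 : (U * Λ * Uᴴ * ((V * Y * Uᴴ)ᴴ * (V * Y * Uᴴ))).trace.re =
      ∑ i, ∑ j, lam i * z i j ^ 2 * Complex.normSq (G j i) := by
    have : (U * Λ * Uᴴ * ((V * Y * Uᴴ)ᴴ * (V * Y * Uᴴ))).trace = (Λ * (Yᴴ * Y)).trace := by
      simp only [Matrix.conjTranspose_mul, Matrix.conjTranspose_conjTranspose]
      have e1 : U * Λ * Uᴴ * (U * (Yᴴ * Vᴴ) * (V * Y * Uᴴ)) =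
          U * (Λ * (Uᴴ * U) * Yᴴ * (Vᴴ * V) * Y * Uᴴ) := by simp only [mul_assoc]
      rw [e1, hU, hV, Matrix.trace_mul_comm, mul_one, mul_one, mul_assoc _ Uᴴ U, hU, mul_one,
        mul_assoc]
    rw [this, trace_diagonal_mul_conjTranspose_mul]
    simp only [hnorm, Complex.re_sum, ← Complex.ofReal_mul, Complex.ofReal_re, mul_assoc]
  have h4 : (V * Δ * Vᴴ * ((V * Y * Uᴴ) * (V * Y * Uᴴ)ᴴ)).trace.re =
      ∑ i, ∑ j, mu j * z i j ^ 2 * Complex.normSq (G j i) := by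
    have : (V * Δ * Vᴴ * ((V * Y * Uᴴ) * (V * Y * Uᴴ)ᴴ)).trace = (Δ * (Yᴴᴴ * Yᴴ)).trace := by
      simp only [Matrix.conjTranspose_mul, Matrix.conjTranspose_conjTranspose]
      have e1 : V * Δ * Vᴴ * (V * Y * Uᴴ * (U * (Yᴴ * Vᴴ))) =
          V * (Δ * (Vᴴ * V) * Y * (Uᴴ * U) * Yᴴ * Vᴴ) := by simp only [mul_assoc]
      rw [e1, hU, hV, Matrix.trace_mul_comm, mul_one, mul_one, mul_assoc _ Vᴴ V, hV, mul_one,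
        mul_assoc]
    rw [this, trace_diagonal_mul_conjTranspose_mul, Finset.sum_comm]
    simp only [Matrix.conjTranspose_apply, star_star, mul_comm (Y _ _), hnorm, Complex.re_sum,
      ← Complex.ofReal_mul, Complex.ofReal_re, mul_assoc]
  simp only [nodeTerm, mul_add, mul_one, Matrix.trace_add, Complex.add_re, mul_smul_comm,
    Matrix.trace_smul, Complex.smul_re, smul_eq_mul]
  rw [h0, h1, h2, h3, h4, Finset.mul_sum, Finset.mul_sum]
  simp only [← Finset.sum_add_distrib]
  refine Finset.sum_congr rfl fun i _ => ?_
  rw [Finset.mul_sum, Finset.mul_sum]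
  simp only [← Finset.sum_add_distrib]
  refine Finset.sum_congr rfl fun j _ => ?_
  ring

/-- If `ρ ≤ τ`, then the kernel of `τ` is orthogonal to the support of `ρ`. -/
theorem overlap_eq_zero (hlam : ∀ i, 0 ≤ lam i) (hV : Vᴴ * V = 1)
    (hle : (V * Matrix.diagonal (fun j => (mu j : ℂ)) * Vᴴ -
      U * Matrix.diagonal (fun i => (lam i : ℂ)) * Uᴴ).PosSemidef) {i j : e} (hj : mu j = 0) :
    lam i * Complex.normSq ((Vᴴ * U) j i) = 0 := by
  have h := (hle.conjTranspose_mul_mul_same V).diag_nonneg (i := j)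
  have e1 : Vᴴ * (V * Matrix.diagonal (fun j => (mu j : ℂ)) * Vᴴ -
      U * Matrix.diagonal (fun i => (lam i : ℂ)) * Uᴴ) * V =
      Matrix.diagonal (fun j => (mu j : ℂ)) -
        (Vᴴ * U) * (Matrix.diagonal (fun i => (lam i : ℂ)) * (Vᴴ * U)ᴴ) := by
    have e2 : Vᴴ * (V * Matrix.diagonal (fun j => (mu j : ℂ)) * Vᴴ) * V =
        (Vᴴ * V) * Matrix.diagonal (fun j => (mu j : ℂ)) * (Vᴴ * V) := by simp only [mul_assoc]
    rw [mul_sub, sub_mul, e2, hV, one_mul, mul_one, Matrix.conjTranspose_mul,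
      Matrix.conjTranspose_conjTranspose]
    simp only [mul_assoc]
  rw [e1, Matrix.sub_apply, Matrix.diagonal_apply_eq, hj, Matrix.mul_apply] at h
  have e3 : ∀ k, (Vᴴ * U) j k * (Matrix.diagonal (fun i => (lam i : ℂ)) * (Vᴴ * U)ᴴ) k j =
      ((lam k * Complex.normSq ((Vᴴ * U) j k) : ℝ) : ℂ) := by
    intro k
    rw [Matrix.diagonal_mul, Matrix.conjTranspose_apply, mul_left_comm, mul_comm ((Vᴴ * U) j k),
      star_mul_self_eq_normSq, Complex.ofReal_mul]
  simp only [e3, Complex.ofReal_zero, zero_sub, ← Complex.ofReal_sum, ← Complex.ofReal_neg] at h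
  have h' := Complex.zero_le_real.1 h
  have hnn : ∀ k ∈ Finset.univ, 0 ≤ lam k * Complex.normSq ((Vᴴ * U) j k) := fun k _ =>
    mul_nonneg (hlam k) (Complex.normSq_nonneg _)
  have h0 := le_antisymm (by linarith) (Finset.sum_nonneg hnn)
  exact (Finset.sum_eq_zero_iff_of_nonneg hnn).1 h0 i (Finset.mem_univ i)

/-- The scalar bound, homogenized: `λ ^ α μ ^ (1 - α)` is at most the optimal value of the
quadratic expressions in `nodeTerm_spectral`. -/
theorem rpow_mul_rpow_le {α : ℝ} (hα : 1 < α) {m : ℕ} {s v : Fin m → ℝ}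
    (hs : ∀ i, s i ∈ Set.Ioc (0 : ℝ) 1)
    (hv : ∀ x : ℝ, 0 < x → x ^ (α - 1) ≤ 1 + ∑ i, v i * ((x - 1) / ((1 - s i) * x + s i)))
    {l u : ℝ} (hl : 0 ≤ l) (hu : 0 < u) :
    l ^ α * u ^ (1 - α) ≤ l - ∑ k, v k / s k * (l + 2 * l * (-l / ((1 - s k) * l + s k * u)) +
      ((1 - s k) * l + s k * u) * (-l / ((1 - s k) * l + s k * u)) ^ 2) := by
  rcases hl.eq_or_lt with rfl | hl
  · rw [Real.zero_rpow (by linarith)]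
    simp
  -- With `D = (1 - s k) l + s k u`, the quadratic `l + 2 l z + D z²` is minimal at `z = -l / D`,
  -- with value `l (D - l) / D`. This is a multiple of the quadrature term at `x = l / u`.
  have hx := mul_le_mul_of_nonneg_left (hv (l / u) (div_pos hl hu)) hl.le
  have e1 : l * (l / u) ^ (α - 1) = l ^ α * u ^ (1 - α) := by
    rw [Real.div_rpow hl.le hu.le, ← mul_div_assoc, ← Real.rpow_one_add' hl.le (by linarith),
      div_eq_mul_inv, ← Real.rpow_neg hu.le]
    congr 2 <;> ring
  rw [e1, mul_add, mul_one, Finset.mul_sum] at hx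
  refine hx.trans_eq ?_
  rw [sub_eq_add_neg l, ← Finset.sum_neg_distrib]
  congr 1
  refine Finset.sum_congr rfl fun k _ => ?_
  have hD : 0 < (1 - s k) * l + s k * u :=
    add_pos_of_nonneg_of_pos (mul_nonneg (sub_nonneg.2 (hs k).2) hl.le) (mul_pos (hs k).1 hu)
  have hD' : (1 - s k) * (l / u) + s k = ((1 - s k) * l + s k * u) / u := by field_simp
  have hs0 := (hs k).1.ne'
  have hDl : (1 - s k) * l + s k * u - l = s k * (u - l) := by ring
  rw [hD']
  generalize (1 - s k) * l + s k * u = D at hD hDl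
  have e2 : l + 2 * l * (-l / D) + D * (-l / D) ^ 2 = l * (D - l) / D := by
    field_simp
    ring
  rw [e2, hDl]
  field_simp
  ring

/-- The one-block bound: for `0 ≤ ρ ≤ τ`, a discretization of the power function as in
`GaussRadau.exists_rpow_le` bounds `Tr[ρ ^ α τ ^ (1 - α)]` by a value of the polynomial
objective. -/
theorem exists_trace_mpow_le {ρ τ : Matrix e e ℂ} (hρ : ρ.PosSemidef) (hτ : τ.PosSemidef)
    (hle : (τ - ρ).PosSemidef) {α : ℝ} (hα : 1 < α) {m : ℕ} {s v : Fin m → ℝ}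
    (hs : ∀ i, s i ∈ Set.Ioc (0 : ℝ) 1)
    (hv : ∀ x : ℝ, 0 < x → x ^ (α - 1) ≤ 1 + ∑ i, v i * ((x - 1) / ((1 - s i) * x + s i))) :
    ∃ Z : Fin m → Matrix e e ℂ, (mpow ρ α * mpow τ (1 - α)).trace.re ≤
      ρ.trace.re - ∑ i, v i / s i * nodeTerm ρ τ (s i) (Z i) := by
  obtain ⟨U, lam, hU, -, hlam, hρe, hρp⟩ := exists_spectral hρ
  obtain ⟨V, mu, hV, hV', hmu, hτe, hτp⟩ := exists_spectral hτ
  -- The entries are the scalar minimizers of `rpow_mul_rpow_le`, weighted by the overlaps of the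
  -- eigenbases.
  refine ⟨fun k => V * Matrix.of (fun j i =>
    ((-lam i / ((1 - s k) * lam i + s k * mu j) : ℝ) : ℂ) * (Vᴴ * U) j i) * Uᴴ, ?_⟩
  have htr : ρ.trace.re = ∑ i, ∑ j, lam i * Complex.normSq ((Vᴴ * U) j i) := by
    have := trace_spectral_mul (U := U) (V := V) lam fun _ => (1 : ℝ)
    simp only [Complex.ofReal_one, Matrix.diagonal_one, mul_one] at this
    rw [hV', mul_one, ← hρe] at this
    rw [this, Complex.ofReal_re]
  rw [htr, hρp, hτp, trace_spectral_mul, Complex.ofReal_re, hρe, hτe]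
  simp only [nodeTerm_spectral hU hV hV', Finset.mul_sum]
  rw [Finset.sum_comm (s := (Finset.univ : Finset (Fin m))), ← Finset.sum_sub_distrib]
  refine Finset.sum_le_sum fun i _ => ?_
  rw [Finset.sum_comm (s := (Finset.univ : Finset (Fin m))), ← Finset.sum_sub_distrib]
  refine Finset.sum_le_sum fun j _ => ?_
  set g := Complex.normSq ((Vᴴ * U) j i) with hg
  have hg0 : 0 ≤ g := Complex.normSq_nonneg _
  -- The scalar bound needs `μ_j > 0`. On the kernel of `τ`, `ρ ≤ τ` forces `λ_i = 0` or zero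
  -- overlap, and both sides vanish.
  rcases (hmu j).eq_or_lt with hj | hj
  · have hz : lam i * g = 0 := overlap_eq_zero hlam hV (by rw [← hρe, ← hτe]; exact hle) hj.symm
    rcases mul_eq_zero.1 hz with h | h
    · rw [h, Real.zero_rpow (by linarith)]
      simp
    · simp [h]
  · have := mul_le_mul_of_nonneg_right (rpow_mul_rpow_le hα hs hv (hlam i) hj) hg0
    refine this.trans_eq ?_
    rw [sub_mul, Finset.sum_mul]
    simp only [mul_assoc]

end TraceBound

/-! ### Reindexing, positivity and partial traces. -/

theorem trace_reindex {n o : Type*} [Fintype n] [Fintype o] (e : n ≃ o) (M : Matrix n n ℂ) :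
    (Matrix.reindex e e M).trace = M.trace :=
  Equiv.sum_comp e.symm fun i => M i i

theorem reindex_mul_reindex {n o : Type*} [Fintype n] [Fintype o] (e : n ≃ o) (M N : Matrix n n ℂ) :
    Matrix.reindex e e M * Matrix.reindex e e N = Matrix.reindex e e (M * N) :=
  Matrix.submatrix_mul_equiv M N _ _ _

section PosSemidef

variable {n o : Type*} [Fintype n] [DecidableEq n]

open scoped MatrixOrder in
theorem exists_eq_conjTranspose_mul_self {K : Matrix n n ℂ} (hK : K.PosSemidef) :
    ∃ G : Matrix n n ℂ, K = Gᴴ * G :=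
  CStarAlgebra.nonneg_iff_eq_star_mul_self.1 hK.nonneg

theorem posSemidef_blockDiagonal [Fintype o] [DecidableEq o] {M : o → Matrix n n ℂ}
    (hM : ∀ i, (M i).PosSemidef) : (Matrix.blockDiagonal M).PosSemidef := by
  choose G hG using fun i => exists_eq_conjTranspose_mul_self (hM i)
  rw [funext hG, Matrix.blockDiagonal_mul, ← Matrix.blockDiagonal_conjTranspose]
  exact Matrix.posSemidef_conjTranspose_mul_self _

end PosSemidef

section PartialTrace

variable {qA qB e : Type*} [Fintype qA] [Fintype qB]

theorem ptraceAB_eq_sum_submatrix (S : Matrix (qA × qB × e) (qA × qB × e) ℂ) :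
    ptraceAB S = ∑ i, ∑ j, S.submatrix (fun k => (i, j, k)) (fun k => (i, j, k)) := by
  ext k k'
  simp [ptraceAB, Matrix.sum_apply]

theorem ptraceAB_sum {ι : Type*} (s : Finset ι)
    (S : ι → Matrix (qA × qB × e) (qA × qB × e) ℂ) :
    ptraceAB (∑ u ∈ s, S u) = ∑ u ∈ s, ptraceAB (S u) := by
  let φ : Matrix (qA × qB × e) (qA × qB × e) ℂ →+ Matrix e e ℂ :=
    { toFun := ptraceAB
      map_zero' := by ext; simp [ptraceAB]
      map_add' := fun S T => by ext; simp [ptraceAB, Finset.sum_add_distrib] }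
  exact map_sum φ S s

theorem ptraceAB_posSemidef {S : Matrix (qA × qB × e) (qA × qB × e) ℂ} (hS : S.PosSemidef) :
    (ptraceAB S).PosSemidef := by
  rw [ptraceAB_eq_sum_submatrix]
  exact Matrix.posSemidef_sum _ fun i _ => Matrix.posSemidef_sum _ fun j _ => hS.submatrix _

theorem trace_ptraceAB [Fintype e] (S : Matrix (qA × qB × e) (qA × qB × e) ℂ) :
    (ptraceAB S).trace = S.trace := by
  simp only [Matrix.trace, Matrix.diag, ptraceAB, Matrix.of_apply, Fintype.sum_prod_type]
  rw [Finset.sum_comm]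
  refine Finset.sum_congr rfl fun i _ => ?_
  rw [Finset.sum_comm]

theorem ptraceAB_mul_one_kronecker [Fintype e] [DecidableEq qA] [DecidableEq qB]
    (S : Matrix (qA × qB × e) (qA × qB × e) ℂ) (W : Matrix e e ℂ) :
    ptraceAB (S * ((1 : Matrix qA qA ℂ) ⊗ₖ ((1 : Matrix qB qB ℂ) ⊗ₖ W))) = ptraceAB S * W := by
  ext k k'
  have h : ∀ i j, (S * ((1 : Matrix qA qA ℂ) ⊗ₖ ((1 : Matrix qB qB ℂ) ⊗ₖ W))) (i, j, k) (i, j, k') =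
      ∑ l, S (i, j, k) (i, j, l) * W l k' := by
    intro i j
    simp [Matrix.mul_apply, Fintype.sum_prod_type, Matrix.one_apply, Finset.sum_ite_irrel]
  rw [Matrix.mul_apply (M := ptraceAB S)]
  simp only [ptraceAB, Matrix.of_apply, h, Finset.sum_mul]
  rw [Finset.sum_comm (s := (Finset.univ : Finset e))]
  exact Finset.sum_congr rfl fun i _ => Finset.sum_comm

variable [Fintype e] [DecidableEq e]

theorem ptraceAB_kronecker_mul_comm (K : Matrix qA qA ℂ) (N : Matrix qB qB ℂ)
    (S : Matrix (qA × qB × e) (qA × qB × e) ℂ) :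
    ptraceAB ((K ⊗ₖ (N ⊗ₖ (1 : Matrix e e ℂ))) * S) =
      ptraceAB (S * (K ⊗ₖ (N ⊗ₖ (1 : Matrix e e ℂ)))) := by
  ext k k'
  simp only [ptraceAB, Matrix.of_apply, Matrix.mul_apply, Fintype.sum_prod_type,
    Matrix.kroneckerMap_apply, Matrix.one_apply, ite_mul, zero_mul, mul_ite, mul_one, mul_zero,
    Finset.sum_ite_eq, Finset.sum_ite_eq', Finset.mem_univ, if_true]
  refine (Finset.sum_congr rfl fun i _ => Finset.sum_comm).trans ?_
  refine Eq.trans ?_ (Finset.sum_congr rfl fun i _ => Finset.sum_comm).symm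
  rw [Finset.sum_comm]
  refine Finset.sum_congr rfl fun i _ => Finset.sum_congr rfl fun i' _ => ?_
  rw [Finset.sum_comm]
  exact Finset.sum_congr rfl fun j _ => Finset.sum_congr rfl fun j' _ => mul_comm _ _

/-- The product with `S` need not be Hermitian. Factoring the measurement operator as `F† F` and
cycling `F†`, which acts trivially on `E`, under the partial trace gives that of `F S F†`. -/
theorem ptraceAB_measurement_posSemidef {K : Matrix qA qA ℂ} {N : Matrix qB qB ℂ}
    {S : Matrix (qA × qB × e) (qA × qB × e) ℂ} (hK : K.PosSemidef) (hN : N.PosSemidef)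
    (hS : S.PosSemidef) : (ptraceAB ((K ⊗ₖ (N ⊗ₖ (1 : Matrix e e ℂ))) * S)).PosSemidef := by
  classical
  obtain ⟨G, rfl⟩ := exists_eq_conjTranspose_mul_self hK
  obtain ⟨H, rfl⟩ := exists_eq_conjTranspose_mul_self hN
  have e1 : (Gᴴ * G) ⊗ₖ ((Hᴴ * H) ⊗ₖ (1 : Matrix e e ℂ)) =
      (Gᴴ ⊗ₖ (Hᴴ ⊗ₖ (1 : Matrix e e ℂ))) * (G ⊗ₖ (H ⊗ₖ (1 : Matrix e e ℂ))) := by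
    rw [← Matrix.mul_kronecker_mul, ← Matrix.mul_kronecker_mul, one_mul]
  have e2 : Gᴴ ⊗ₖ (Hᴴ ⊗ₖ (1 : Matrix e e ℂ)) = (G ⊗ₖ (H ⊗ₖ (1 : Matrix e e ℂ)))ᴴ := by
    rw [Matrix.conjTranspose_kronecker, Matrix.conjTranspose_kronecker, Matrix.conjTranspose_one]
  rw [e1, mul_assoc, ptraceAB_kronecker_mul_comm, e2]
  exact ptraceAB_posSemidef (hS.mul_mul_conjTranspose_same _)

theorem trace_mul_kronecker [DecidableEq qA] [DecidableEq qB] (K : Matrix qA qA ℂ)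
    (N : Matrix qB qB ℂ) (W : Matrix e e ℂ) (S : Matrix (qA × qB × e) (qA × qB × e) ℂ) :
    (S * (K ⊗ₖ (N ⊗ₖ W))).trace =
      (ptraceAB ((K ⊗ₖ (N ⊗ₖ (1 : Matrix e e ℂ))) * S) * W).trace := by
  rw [← ptraceAB_mul_one_kronecker, trace_ptraceAB, Matrix.trace_mul_cycle,
    ← Matrix.mul_kronecker_mul, ← Matrix.mul_kronecker_mul, one_mul, one_mul, mul_one,
    Matrix.trace_mul_comm]

end PartialTrace

/-! ### Block structure of a round and the decomposition of `p`. -/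

namespace SingleRound

variable {X Y A B C qA qB e : Type*} [Fintype X] [Fintype Y] [Fintype A] [Fintype B]
  [Fintype qA] [Fintype qB] [Fintype e] [DecidableEq C]
  [DecidableEq qA] [DecidableEq qB] [DecidableEq e]

/-- The unnormalized state of `E` for the outcomes `a` and `c̄`. -/
noncomputable def block (R : SingleRound X Y A B C qA qB e) (c : C) (x : X) (y : Y) (t : Fin 2)
    (a : A) : Matrix e e ℂ :=
  ∑ b with R.f a b x y t = c, ptraceAB ((R.M x a ⊗ₖ (R.N y b ⊗ₖ (1 : Matrix e e ℂ))) * R.σ)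

variable (R : SingleRound X Y A B C qA qB e) (c : C) (x : X) (y : Y) (t : Fin 2) (a : A)

theorem block_posSemidef : (R.block c x y t a).PosSemidef :=
  Matrix.posSemidef_sum _ fun b _ => ptraceAB_measurement_posSemidef
    ((R.M_povm x).posSemidef a) ((R.N_povm y).posSemidef b) R.σ_posSemidef

theorem probAC_eq_trace : R.probAC a c x y t = (R.block c x y t a).trace.re := by
  rw [block, Matrix.trace_sum, Complex.re_sum, probAC]
  simp only [trace_ptraceAB, born]

theorem probAC_nonneg : 0 ≤ R.probAC a c x y t := by
  rw [probAC_eq_trace]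
  exact (Complex.nonneg_iff.1 (R.block_posSemidef c x y t a).trace_nonneg).1

theorem block_eq_zero (h : R.probAC a c x y t = 0) : R.block c x y t a = 0 := by
  have hps := R.block_posSemidef c x y t a
  rw [← hps.trace_eq_zero_iff]
  rw [probAC_eq_trace] at h
  exact Complex.ext h (Complex.nonneg_iff.1 hps.trace_nonneg).2.symm

theorem probC_nonneg : 0 ≤ R.probC c x y t :=
  Finset.sum_nonneg fun a _ => R.probAC_nonneg c x y t a

theorem block_eq_zero_of_probC (h : ¬ 0 < R.probC c x y t) : R.block c x y t a = 0 := by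
  have h0 : R.probC c x y t = 0 := le_antisymm (not_lt.1 h) (R.probC_nonneg c x y t)
  exact R.block_eq_zero c x y t a
    ((Finset.sum_eq_zero_iff_of_nonneg fun a _ => R.probAC_nonneg c x y t a).1 h0 a
      (Finset.mem_univ a))

theorem block_eq_zero_of_probAgivenC (h : ¬ 0 < R.probAgivenC a c x y t) :
    R.block c x y t a = 0 := by
  by_cases hC : 0 < R.probC c x y t
  · refine R.block_eq_zero c x y t a (le_antisymm ?_ (R.probAC_nonneg c x y t a))
    by_contra! hA
    exact h (div_pos hA hC)
  · exact R.block_eq_zero_of_probC c x y t a hC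

theorem sum_block [Fintype C] :
    ∑ a, ∑ c, R.block c x y t a = ptraceAB R.σ := by
  have h1 : ∀ a, ∑ c, R.block c x y t a =
      ∑ b, ptraceAB ((R.M x a ⊗ₖ (R.N y b ⊗ₖ (1 : Matrix e e ℂ))) * R.σ) := fun a =>
    Finset.sum_fiberwise Finset.univ (fun b => R.f a b x y t) _
  simp only [h1, ← ptraceAB_sum, ← Finset.sum_mul]
  have h2 : ∑ a, ∑ b, R.M x a ⊗ₖ (R.N y b ⊗ₖ (1 : Matrix e e ℂ)) =
      (∑ a, R.M x a) ⊗ₖ ((∑ b, R.N y b) ⊗ₖ (1 : Matrix e e ℂ)) := by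
    ext i j
    simp only [Matrix.sum_apply, Matrix.kroneckerMap_apply, Finset.sum_mul, Finset.mul_sum]
    exact Finset.sum_comm
  rw [h2, (R.M_povm x).sum_eq_one, (R.N_povm y).sum_eq_one, Matrix.one_kronecker_one,
    Matrix.one_kronecker_one, one_mul]

/-- The blocks over all `(a, c̄)` sum to the marginal on `E`, so the difference is the sum of the
other, positive semidefinite blocks. -/
theorem ptraceAB_sub_block_posSemidef [Fintype C] :
    (ptraceAB R.σ - R.block c x y t a).PosSemidef := by
  classical
  rw [← R.sum_block x y t, ← Fintype.sum_prod_type' (f := fun a c => R.block c x y t a),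
    ← Finset.add_sum_erase Finset.univ (fun u : A × C => R.block u.2 x y t u.1)
      (Finset.mem_univ (a, c)), add_sub_cancel_left]
  exact Matrix.posSemidef_sum _ fun u _ => R.block_posSemidef _ _ _ _ _

theorem condOut_apply [DecidableEq A] (a a' : A) (c c' : C) (k k' : e) :
    R.condOut x y t (a, c, k) (a', c', k') =
      if a = a' ∧ c = c' then R.block c x y t a k k' else 0 := by
  simp only [condOut, Matrix.sum_apply, Matrix.kroneckerMap_apply, Matrix.single_apply]
  rw [Finset.sum_eq_single a (fun a₁ _ h => Finset.sum_eq_zero fun b _ => by simp [h]) (by simp)]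
  by_cases ha : a = a'
  · by_cases hc : c = c'
    · subst ha hc
      simp only [block, Matrix.sum_apply, Finset.sum_filter, and_self, if_true, one_mul, ite_mul,
        zero_mul]
    · have : ∀ b, ¬ (R.f a b x y t = c ∧ R.f a b x y t = c') := fun b h => hc (h.1.symm.trans h.2)
      simp [this, hc]
  · simp [ha]

theorem sum_condOut [Fintype C] [DecidableEq A] (k k' : e) :
    ∑ a, ∑ c, R.condOut x y t (a, c, k) (a, c, k') = ptraceAB R.σ k k' := by
  rw [← R.sum_block x y t]
  simp [condOut_apply, Matrix.sum_apply]

theorem out_apply [DecidableEq X] [DecidableEq Y] [DecidableEq A] (i j : A × C × e)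
    (v v' : X × Y × Fin 2) :
    R.out (i, v) (j, v') =
      if v = v' then (R.P v.1 v.2.1 v.2.2 : ℂ) * R.condOut v.1 v.2.1 v.2.2 i j else 0 := by
  have h : R.out (i, v) (j, v') = ∑ u : X × Y × Fin 2, (R.P u.1 u.2.1 u.2.2 •
      (R.condOut u.1 u.2.1 u.2.2 ⊗ₖ Matrix.single u u (1 : ℂ))) (i, v) (j, v') := by
    simp only [out, Matrix.sum_apply, Fintype.sum_prod_type]
  rw [h, Finset.sum_eq_single v _ (by simp)]
  · simp only [Matrix.smul_apply, Matrix.kroneckerMap_apply, Matrix.single_apply, true_and,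
      Complex.real_smul]
    split_ifs <;> simp
  · intro u _ hu
    simp [Matrix.kroneckerMap_apply, hu]

theorem condTest_eq [DecidableEq A] :
    R.condTest c x y t = Matrix.reindex (Equiv.prodComm e A) (Equiv.prodComm e A)
      (Matrix.blockDiagonal (R.block c x y t)) := by
  ext ⟨a, k⟩ ⟨a', k'⟩
  simp [condTest, condOut_apply, Matrix.blockDiagonal_apply]

theorem condTest_posSemidef [DecidableEq A] : (R.condTest c x y t).PosSemidef := by
  rw [condTest_eq]
  exact (posSemidef_blockDiagonal (R.block_posSemidef c x y t)).submatrix _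

theorem mpow_condTest [DecidableEq A] (s : ℝ) :
    mpow (R.condTest c x y t) s = Matrix.reindex (Equiv.prodComm e A) (Equiv.prodComm e A)
      (Matrix.blockDiagonal fun a => mpow (R.block c x y t a) s) := by
  have hH : ∀ a, (R.block c x y t a).IsHermitian := fun a => (R.block_posSemidef c x y t a).1
  rw [condTest_eq, mpow_reindex (isHermitian_blockDiagonal hH), mpow_blockDiagonal hH]

variable [DecidableEq X] [DecidableEq Y] [DecidableEq A]

theorem outTest_eq :
    R.outTest c = Matrix.reindex (Equiv.prodAssoc A e (X × Y × Fin 2))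
      (Equiv.prodAssoc A e (X × Y × Fin 2))
      (Matrix.blockDiagonal fun v : X × Y × Fin 2 =>
        R.P v.1 v.2.1 v.2.2 • R.condTest c v.1 v.2.1 v.2.2) := by
  ext ⟨a, k, v⟩ ⟨a', k', v'⟩
  simp [outTest, out_apply, Matrix.blockDiagonal_apply, condTest]

variable [Fintype C]

theorem outXYTE_eq :
    R.outXYTE = Matrix.blockDiagonal fun v : X × Y × Fin 2 =>
      R.P v.1 v.2.1 v.2.2 • ptraceAB R.σ := by
  ext ⟨k, v⟩ ⟨k', v'⟩
  simp only [outXYTE, Matrix.of_apply, out_apply, Matrix.blockDiagonal_apply]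
  split_ifs with h
  · simp only [← Finset.mul_sum, sum_condOut, Matrix.smul_apply, Complex.real_smul]
  · simp

theorem outE_eq : R.outE = ptraceAB R.σ := by
  ext k k'
  simp only [outE, Matrix.of_apply, out_apply, if_true]
  simp only [fun a => Finset.sum_comm (s := (Finset.univ : Finset C))
    (t := (Finset.univ : Finset (X × Y × Fin 2)))
    (f := fun c v => (R.P v.1 v.2.1 v.2.2 : ℂ) * R.condOut v.1 v.2.1 v.2.2 (a, c, k) (a, c, k'))]
  rw [Finset.sum_comm]
  simp only [← Finset.mul_sum, sum_condOut, ← Finset.sum_mul]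
  have : ∑ v : X × Y × Fin 2, (R.P v.1 v.2.1 v.2.2 : ℂ) = 1 := by
    simp only [Fintype.sum_prod_type]
    exact_mod_cast R.P_sum
  rw [this, one_mul]

theorem condTerm_eq (α : ℝ) : R.condTerm α c x y t =
    ∑ a, (mpow (R.block c x y t a) α * mpow (ptraceAB R.σ) (1 - α)).trace := by
  have h : (1 : Matrix A A ℂ) ⊗ₖ mpow (ptraceAB R.σ) (1 - α) =
      Matrix.reindex (Equiv.prodComm e A) (Equiv.prodComm e A)
        (Matrix.blockDiagonal fun _ => mpow (ptraceAB R.σ) (1 - α)) := by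
    ext ⟨a, k⟩ ⟨a', k'⟩
    simp [Matrix.blockDiagonal_apply, Matrix.one_apply]
  rw [condTerm, outE_eq, mpow_condTest, h, reindex_mul_reindex, trace_reindex,
    ← Matrix.blockDiagonal_mul, Matrix.trace_blockDiagonal]

theorem condTerm_eq_zero {α : ℝ} (hα : α ≠ 0) (h : ¬ 0 < R.probC c x y t) :
    R.condTerm α c x y t = 0 := by
  rw [condTerm_eq]
  refine Finset.sum_eq_zero fun a _ => ?_
  rw [R.block_eq_zero_of_probC c x y t a h, mpow_zero hα, zero_mul, Matrix.trace_zero]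

theorem p_eq_sum {α : ℝ} (hα : 1 < α) :
    R.p α c = ∑ v : X × Y × Fin 2 with 0 < R.probC c v.1 v.2.1 v.2.2,
        (R.P v.1 v.2.1 v.2.2 : ℂ) * R.condTerm α c v.1 v.2.1 v.2.2 := by
  have hps : ∀ v : X × Y × Fin 2,
      (R.P v.1 v.2.1 v.2.2 • R.condTest c v.1 v.2.1 v.2.2).PosSemidef := fun v =>
    (R.condTest_posSemidef c _ _ _).smul (R.P_nonneg _ _ _)
  have hE : (ptraceAB R.σ).PosSemidef := ptraceAB_posSemidef R.σ_posSemidef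
  have h1 : mpow (R.outTest c) α = Matrix.reindex (Equiv.prodAssoc A e (X × Y × Fin 2))
      (Equiv.prodAssoc A e (X × Y × Fin 2)) (Matrix.blockDiagonal fun v : X × Y × Fin 2 =>
        R.P v.1 v.2.1 v.2.2 ^ α • mpow (R.condTest c v.1 v.2.1 v.2.2) α) := by
    rw [outTest_eq, mpow_reindex (isHermitian_blockDiagonal fun v => (hps v).1),
      mpow_blockDiagonal fun v => (hps v).1]
    simp only [fun v : X × Y × Fin 2 =>
      mpow_smul (R.condTest_posSemidef c v.1 v.2.1 v.2.2) (R.P_nonneg v.1 v.2.1 v.2.2) α]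
  have h2 : mpow R.outXYTE (1 - α) = Matrix.blockDiagonal fun v : X × Y × Fin 2 =>
      R.P v.1 v.2.1 v.2.2 ^ (1 - α) • mpow (ptraceAB R.σ) (1 - α) := by
    rw [outXYTE_eq, mpow_blockDiagonal fun v : X × Y × Fin 2 => (hE.smul (R.P_nonneg _ _ _)).1]
    simp only [fun v : X × Y × Fin 2 => mpow_smul hE (R.P_nonneg v.1 v.2.1 v.2.2) (1 - α)]
  have h3 : (1 : Matrix A A ℂ) ⊗ₖ mpow R.outXYTE (1 - α) =
      Matrix.reindex (Equiv.prodAssoc A e (X × Y × Fin 2)) (Equiv.prodAssoc A e (X × Y × Fin 2))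
      (Matrix.blockDiagonal fun v : X × Y × Fin 2 =>
        R.P v.1 v.2.1 v.2.2 ^ (1 - α) • ((1 : Matrix A A ℂ) ⊗ₖ mpow R.outE (1 - α))) := by
    rw [h2, outE_eq]
    ext ⟨a, k, v⟩ ⟨a', k', v'⟩
    simp only [Matrix.kroneckerMap_apply, Matrix.blockDiagonal_apply, Matrix.reindex_apply,
      Matrix.submatrix_apply, Equiv.prodAssoc_symm_apply, Matrix.smul_apply, mul_ite, mul_zero,
      mul_smul_comm]
  have h4 : R.p α c = ∑ v : X × Y × Fin 2,
      (R.P v.1 v.2.1 v.2.2 : ℂ) * R.condTerm α c v.1 v.2.1 v.2.2 := by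
    rw [p, h1, h3, reindex_mul_reindex, trace_reindex, ← Matrix.blockDiagonal_mul,
      Matrix.trace_blockDiagonal]
    refine Finset.sum_congr rfl fun v _ => ?_
    -- The exponents `α` and `1 - α` add up to `1 ≠ 0`, so the power law also covers `P = 0`.
    rw [smul_mul_smul_comm, Matrix.trace_smul, Complex.real_smul, condTerm,
      ← Real.rpow_add' (R.P_nonneg _ _ _) (by norm_num), add_sub_cancel, Real.rpow_one]
  rw [h4, Finset.sum_filter_of_ne]
  intro v _ hv
  by_contra h
  exact hv (by rw [R.condTerm_eq_zero c _ _ _ (by linarith) h, mul_zero])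

end SingleRound

/-! ### Choice of nodes and weights. -/

theorem sin_mul_pi_div_pi_neg {α : ℝ} (hα₁ : 1 < α) (hα₂ : α < 2) :
    Real.sin (α * Real.pi) / Real.pi < 0 := by
  have hpi := Real.pi_pos
  refine div_neg_of_neg_of_pos ?_ hpi
  have h : Real.sin (α * Real.pi) = -Real.sin ((α - 1) * Real.pi) := by
    rw [← Real.sin_add_pi]
    congr 1
    ring
  rw [h, neg_lt_zero]
  exact Real.sin_pos_of_pos_of_lt_pi (by nlinarith) (by nlinarith)

/-- The case without nodes: `Tr[ρ ^ α τ ^ (1 - α)] ≤ Tr[ρ]` for `0 ≤ ρ ≤ τ`. -/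
theorem trace_mpow_le_trace {e : Type*} [Fintype e] [DecidableEq e] {ρ τ : Matrix e e ℂ}
    (hρ : ρ.PosSemidef) (hτ : τ.PosSemidef) (hle : (τ - ρ).PosSemidef) {α : ℝ} (hα₁ : 1 < α)
    (hα₂ : α < 2) : (mpow ρ α * mpow τ (1 - α)).trace.re ≤ ρ.trace.re := by
  -- The one-point rule, with its nonnegative node term dropped.
  obtain ⟨s, v, -, hs, hv, hle'⟩ :=
    GaussRadau.exists_rpow_le (β := α - 1) ⟨by linarith, by linarith⟩ 0
  obtain ⟨Z, hZ⟩ := exists_trace_mpow_le hρ hτ hle hα₁ hs hle'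
  refine hZ.trans (sub_le_self _ (Finset.sum_nonneg fun i _ => ?_))
  exact mul_nonneg (div_nonneg (hv i).le (hs i).1.le) (nodeTerm_nonneg hρ hle (hs i) _)

/-- Nodes and weights, depending only on `α` and `m`, for which the polynomial objective bounds
`Tr[ρ ^ α τ ^ (1 - α)]`. The nodes are distinct. -/
theorem exists_nodes_trace_mpow_le {α : ℝ} (hα₁ : 1 < α) (hα₂ : α < 2) (m : ℕ) :
    ∃ s w : Fin m → ℝ, Function.Injective s ∧ (∀ i, s i ∈ Set.Ioc (0 : ℝ) 1) ∧ (∀ i, 0 < w i) ∧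
      ∀ {e : Type*} [Fintype e] [DecidableEq e] (ρ τ : Matrix e e ℂ), ρ.PosSemidef →
        τ.PosSemidef → (τ - ρ).PosSemidef → ∃ Z : Fin m → Matrix e e ℂ,
          (mpow ρ α * mpow τ (1 - α)).trace.re ≤
            (ρ * polyP α s w Z).trace.re + (τ * polyQ α w Z).trace.re := by
  have hκ := sin_mul_pi_div_pi_neg hα₁ hα₂
  cases m with
  | zero =>
    refine ⟨Fin.elim0, Fin.elim0, fun i => i.elim0, fun i => i.elim0, fun i => i.elim0,
      fun ρ τ hρ hτ hle => ⟨Fin.elim0, ?_⟩⟩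
    rw [re_trace_polyP_add_polyQ _ _ _ _ _ fun i => i.elim0]
    simpa using trace_mpow_le_trace hρ hτ hle hα₁ hα₂
  | succ n =>
    obtain ⟨s, v, hinj, hs, hv, hle'⟩ :=
      GaussRadau.exists_rpow_le (β := α - 1) ⟨by linarith, by linarith⟩ n
    -- The weights absorb the negative prefactor of `polyP` and `polyQ`, so that it times `w i` is
    -- `-v i`.
    refine ⟨s, fun i => v i / -(Real.sin (α * Real.pi) / Real.pi), hinj, hs,
      fun i => div_pos (hv i) (neg_pos.2 hκ), fun ρ τ hρ hτ hle => ?_⟩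
    obtain ⟨Z, hZ⟩ := exists_trace_mpow_le hρ hτ hle hα₁ hs hle'
    refine ⟨Z, hZ.trans_eq ?_⟩
    rw [re_trace_polyP_add_polyQ _ _ _ _ _ fun i => (hs i).1.ne', sub_eq_add_neg, Finset.mul_sum,
      ← Finset.sum_neg_distrib]
    congr 1
    refine Finset.sum_congr rfl fun i _ => ?_
    generalize Real.sin (α * Real.pi) / Real.pi = κ at hκ
    have h1 := hκ.ne
    have h2 := (hs i).1.ne'
    field_simp

/-! ### The objective in terms of blocks, and the conclusion. -/

namespace SingleRound

variable {X Y A B C qA qB e : Type*} [Fintype X] [Fintype Y] [Fintype A] [Fintype B]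
  [Fintype qA] [Fintype qB] [Fintype e] [DecidableEq C]
  [DecidableEq qA] [DecidableEq qB] [DecidableEq e]

theorem objective_eq (R : SingleRound X Y A B C qA qB e) (α : ℝ) {m : ℕ} (s w : Fin m → ℝ) (c : C)
    (x : X) (y : Y) (t : Fin 2) (Z : A → Fin m → Matrix e e ℂ) :
    R.objective α s w c x y t Z = ∑ a with 0 < R.probAgivenC a c x y t,
      ((R.block c x y t a * polyP α s w (Z a)).trace.re +
        (ptraceAB R.σ * polyQ α w (Z a)).trace.re) := by
  refine Finset.sum_congr rfl fun a _ => ?_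
  rw [mul_add, Matrix.trace_add, Complex.add_re, Finset.mul_sum, Matrix.trace_sum,
    trace_mul_kronecker 1 1, Matrix.one_kronecker_one, Matrix.one_kronecker_one, one_mul, block,
    Finset.sum_mul, Matrix.trace_sum]
  simp only [trace_mul_kronecker]

theorem bddAbove_objective [Fintype C] (R : SingleRound X Y A B C qA qB e) {α : ℝ} (hα₁ : 1 < α)
    (hα₂ : α < 2) {m : ℕ} {s w : Fin m → ℝ} (hs : ∀ i, s i ∈ Set.Ioc (0 : ℝ) 1)
    (hw : ∀ i, 0 < w i) (c : C) (x : X) (y : Y) (t : Fin 2) :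
    BddAbove (Set.range (R.objective α s w c x y t)) := by
  refine ⟨∑ a with 0 < R.probAgivenC a c x y t, (R.block c x y t a).trace.re, ?_⟩
  rintro _ ⟨Z, rfl⟩
  rw [objective_eq]
  refine Finset.sum_le_sum fun a _ => ?_
  rw [re_trace_polyP_add_polyQ _ _ _ _ _ fun i => (hs i).1.ne']
  refine add_le_of_nonpos_right (mul_nonpos_of_nonpos_of_nonneg
    (sin_mul_pi_div_pi_neg hα₁ hα₂).le (Finset.sum_nonneg fun i _ => ?_))
  exact mul_nonneg (div_nonneg (hw i).le (hs i).1.le) (nodeTerm_nonneg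
    (R.block_posSemidef _ _ _ _ _) (R.ptraceAB_sub_block_posSemidef _ _ _ _ _) (hs i) _)

end SingleRound

end RenyiDI

theorem proposition5 (α : ℝ) (hα₁ : 1 < α) (hα₂ : α < 2) :
    (∀ {X Y A B C qA qB e : Type*} [Fintype X] [Fintype Y] [Fintype A] [Fintype B] [Fintype C]
        [Fintype qA] [Fintype qB] [Fintype e] [DecidableEq X] [DecidableEq Y] [DecidableEq A]
        [DecidableEq C] [DecidableEq qA] [DecidableEq qB] [DecidableEq e]
        (R : RenyiDI.SingleRound X Y A B C qA qB e) (c : C),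
      R.p α c = ∑ v : X × Y × Fin 2 with 0 < R.probC c v.1 v.2.1 v.2.2,
        (R.P v.1 v.2.1 v.2.2 : ℂ) * R.condTerm α c v.1 v.2.1 v.2.2) ∧
    ∀ m : ℕ, ∃ s w : Fin m → ℝ, (∀ i, s i ∈ Set.Ioc (0 : ℝ) 1) ∧ (∀ i, 0 < w i) ∧
      ∀ {X Y A B C qA qB e : Type*} [Fintype X] [Fintype Y] [Fintype A] [Fintype B] [Fintype C]
        [Fintype qA] [Fintype qB] [Fintype e] [DecidableEq X] [DecidableEq Y] [DecidableEq A]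
        [DecidableEq C] [DecidableEq qA] [DecidableEq qB] [DecidableEq e]
        (R : RenyiDI.SingleRound X Y A B C qA qB e) (c : C) (x : X) (y : Y) (t : Fin 2),
        BddAbove (Set.range (R.objective α s w c x y t)) ∧
          (R.condTerm α c x y t).re ≤ ⨆ Z : A → Fin m → Matrix e e ℂ,
            R.objective α s w c x y t Z := by
  refine ⟨fun R c => R.p_eq_sum c hα₁, fun m => ?_⟩
  obtain ⟨s, w, -, hs, hw, hbound⟩ := RenyiDI.exists_nodes_trace_mpow_le hα₁ hα₂ m
  refine ⟨s, w, hs, hw, fun R c x y t => ?_⟩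
  have hbdd := R.bddAbove_objective hα₁ hα₂ hs hw c x y t
  refine ⟨hbdd, ?_⟩
  choose Z hZ using fun a => hbound (R.block c x y t a) (RenyiDI.ptraceAB R.σ)
    (R.block_posSemidef c x y t a) (RenyiDI.ptraceAB_posSemidef R.σ_posSemidef)
    (R.ptraceAB_sub_block_posSemidef c x y t a)
  refine le_trans ?_ (le_ciSup hbdd Z)
  rw [R.condTerm_eq, Complex.re_sum, R.objective_eq]
  -- The objective runs only over outcomes of positive probability; for the others the block is zero
  -- and so is its trace term.
  rw [← Finset.sum_filter_of_ne (p := fun a => 0 < R.probAgivenC a c x y t)]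
  · exact Finset.sum_le_sum fun a _ => hZ a
  · intro a _ ha
    by_contra h
    refine ha ?_
    rw [R.block_eq_zero_of_probAgivenC c x y t a h, RenyiDI.mpow_zero (by linarith), zero_mul,
      Matrix.trace_zero, Complex.zero_re]
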